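/- **Setting.** Fix $d$. Variables are indices ($\mathbb Z$), numbers ($\mathbb R$), booleans, or $d$-dimensional arrays $\mathbb Z^d\to\mathbb R$. A *stencil kernel* is a $K$-level nested loop $L^{(1)}\subset\dots\subset L^{(K)}$. The body of $L^{(k)}$ is straight-line SSA code, executed $N_k\ge 1$ times in every invocation, with input, literal, loop-counter (*bound*: $b,\,b+s,\,b+2s,\dots$), arithmetic, comparison, boolean, array *get*/*set*, $\varphi$ and, for $k\ge2$, one or more *Loopcall* operations; a Loopcall executes $L^{(k-1)}$ completely on given actual arguments. Conditional statements are encoded by $\varphi$ operations with branching conditions. A loop-carried variable is defined by a loop-$\varphi$ with an initial value taken from an input, and with (possibly conditional) values that update it at each iteration; when read, it has its value from the end of the previous iteration. Each loop has one output array, defined by a loop-$\varphi$. In the *SSA-based multilevel graph* the vertices of level $k$ are the instances $(m,n,v)$ of the variables $v$ of $L^{(k)}$ (call $m$, iteration $n$), with edges from operands to results. An *invariant graph* of the kernel has, for each level $k$, a graph $G_k^*$ with operations on its vertices and a map from the level-$k$ instances to its vertices that is bijective on every loop slice $(m,n)$, $n\ge 1$, and preserves operations, operands (within and between slices) and the output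 vertex; the loop-entry instance of a loop-$\varphi$ goes to the same vertex as its first-iteration instance. Assume that every strongly connected component (SCC) of every $G_k^*$ contains at most one loop-$\varphi$. **Algorithm.** On $G_k^*$: list the SCCs in a topological order, and initialize the summary $S(v)$ of each input vertex by its variable. For each SCC in this order: (i) for each Loopcall vertex in it, run the algorithm on $G_{k-1}^*$ and set the summary of the vertex to the returned postcondition, with the summaries of the actual arguments substituted for the formal parameters; (ii) if the SCC is a single vertex not on a cycle, apply the summary rule of its operation; otherwise take its loop-$\varphi$ as start vertex, initialize it by its initial value $\hat S$, apply the summary rules in a forward sweep that ends at the start vertex, and then repeat: with $(P_j(x,t),E_j(x,t))_j$ the guarded updates in the summary of the start vertex, and $P=\bigvee_jP_j$, form the generalized summary, which has at position $x$ and iteration $t$ the value $E_j(x,t_1)$ if $1\le t_1\le t$, $P_j(x,t_1)$ holds and $P(x,t_2)$ holds for no $t_1<t_2\le t$, and the value $\hat S(x)$ if there are no such $j,t_1$; replace $t$ by $t-1$ in it, sweep again from it; until the new summary of the start vertex is equivalent to the generalized one for all inputs, all positions and all iterations $1\le t\le N_k$. Finally return the summary of the output vertex at iteration $t=N_k$.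 (A loop-$\varphi$ other than the current start vertex is read in iteration $t$ through its summary at $t-1$, and through its initial value if $t=1$.) Summaries are quantifier-free guarded expressions in the input symbols, the iteration $t$ and the position $x$. **Theorem.** Given an invariant graph of a stencil kernel as above, at every level a topological order of the SCCs, with an admissible sweep order for each SCC, exists. For every choice of these orders and for arbitrary initial contents of the tensor $S$, the hierarchical recursive lifting algorithm, started on $G_K^*$, terminates after finitely many steps (every repeat-until loop ends after a finite number of rounds, bounded by a number that does not depend on the input values), and the summary that it returns is the postcondition of the kernel: for all values of the inputs, after execution of the kernel every element of the output array equals the value of the returned summary at its position. -/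

import Mathlib

namespace StencilLifting

/-! ## Data types and operators -/

/-- Data types of variables: loop/array indices, numbers, booleans, `d`-dimensional arrays. -/
inductive Ty
  | idx | num | bool | arr

/-- The type of one element: numbers for arrays, the type itself for scalars. -/
@[reducible] def Ty.elem : Ty → Ty
  | .idx => .idx
  | .num => .num
  | .bool => .bool
  | .arr => .num

/-- Values of each data type. -/
@[reducible] def Val (d : ℕ) : Ty → Type
  | .idx => ℤ
  | .num => ℝ
  | .bool => Bool
  | .arr => (Fin d → ℤ) → ℝ

/-- An arbitrary value, the content of a variable that has not been assigned yet. -/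
noncomputable def Val.dflt (d : ℕ) : (τ : Ty) → Val d τ
  | .idx => 0
  | .num => 0
  | .bool => false
  | .arr => fun _ => 0

/-- Values of the input symbols (formal parameters) of a loop. -/
abbrev Env (d : ℕ) (I : Ty → Type) : Type := ∀ τ, I τ → Val d τ

inductive IdxOp
  | add | sub | mul | div | mod

/-- Division and remainder truncate towards zero. -/
def IdxOp.eval : IdxOp → ℤ → ℤ → ℤ
  | .add, a, b => a + b
  | .sub, a, b => a - b
  | .mul, a, b => a * b
  | .div, a, b => a.tdiv b
  | .mod, a, b => a.tmod b

inductive CmpOp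
  | eq | ne | lt | le | gt | ge

def CmpOp.eval : CmpOp → ℤ → ℤ → Bool
  | .eq, a, b => decide (a = b)
  | .ne, a, b => decide (a ≠ b)
  | .lt, a, b => decide (a < b)
  | .le, a, b => decide (a ≤ b)
  | .gt, a, b => decide (b < a)
  | .ge, a, b => decide (b ≤ a)

inductive NumOp1
  | neg | abs | sqrt

noncomputable def NumOp1.eval : NumOp1 → ℝ → ℝ
  | .neg, a => -a
  | .abs, a => |a|
  | .sqrt, a => Real.sqrt a

inductive NumOp2
  | add | sub | mul | div | min | max

noncomputable def NumOp2.eval : NumOp2 → ℝ → ℝ → ℝ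
  | .add, a, b => a + b
  | .sub, a, b => a - b
  | .mul, a, b => a * b
  | .div, a, b => a / b
  | .min, a, b => Min.min a b
  | .max, a, b => Max.max a b

/-! ## Operations -/

/-- The operation attribute of a vertex of type `τ` at one loop level, together with its ordered
operands. `V` is the family of vertices, `I` the family of input symbols of this loop, and `J` the
family of input symbols of the loop one level below.

* `input s` provides the symbol `s`; literals are input operations without a symbol;
* `bound b s` is the loop counter `b, b + s, b + 2 s, …`;
* `phi brs els` merges execution paths: it takes the value of the first branch
  `(condition, value)` whose condition holds, and `els` if there is none;
* `loopPhi init brs els` is the (extended) `φ` function of a loop-carried variable: it starts from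
  `init` at loop entry, and each iteration gives it the value of the first branch whose condition
  holds, `els` if there is none;
* `loopcall args` is a complete execution of the loop one level below; `args σ s` is the actual
  argument for the formal parameter `s` (`s` and `args σ s` are dual to each other). -/
inductive Op (d : ℕ) (I J V : Ty → Type) : Ty → Type
  | input {τ : Ty} (s : I τ) : Op d I J V τ
  | ilit (c : ℤ) : Op d I J V .idx
  | nlit (c : ℝ) : Op d I J V .num
  | blit (c : Bool) : Op d I J V .bool
  | bound (b s : V .idx) : Op d I J V .idx
  | ineg (a : V .idx) : Op d I J V .idx
  | iop (o : IdxOp) (a b : V .idx) : Op d I J V .idx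
  | nop1 (o : NumOp1) (a : V .num) : Op d I J V .num
  | nop2 (o : NumOp2) (a b : V .num) : Op d I J V .num
  | cmp (o : CmpOp) (a b : V .idx) : Op d I J V .bool
  | and (a b : V .bool) : Op d I J V .bool
  | or (a b : V .bool) : Op d I J V .bool
  | not (a : V .bool) : Op d I J V .bool
  | get (A : V .arr) (ix : Fin d → V .idx) : Op d I J V .num
  | set (A : V .arr) (ix : Fin d → V .idx) (e : V .num) : Op d I J V .arr
  | phi {τ : Ty} (brs : List (V .bool × V τ)) (els : V τ) : Op d I J V τ
  | loopPhi {τ : Ty} (init : V τ) (brs : List (V .bool × V τ)) (els : V τ) : Op d I J V τ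
  | loopcall (args : ∀ σ, J σ → V σ) : Op d I J V .arr

namespace Op

variable {d : ℕ} {I J V V' : Ty → Type}

/-- Renaming of the operands. -/
def map (g : ∀ σ, V σ → V' σ) : {τ : Ty} → Op d I J V τ → Op d I J V' τ
  | _, .input s => .input s
  | _, .ilit c => .ilit c
  | _, .nlit c => .nlit c
  | _, .blit c => .blit c
  | _, .bound b s => .bound (g _ b) (g _ s)
  | _, .ineg a => .ineg (g _ a)
  | _, .iop o a b => .iop o (g _ a) (g _ b)
  | _, .nop1 o a => .nop1 o (g _ a)
  | _, .nop2 o a b => .nop2 o (g _ a) (g _ b)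
  | _, .cmp o a b => .cmp o (g _ a) (g _ b)
  | _, .and a b => .and (g _ a) (g _ b)
  | _, .or a b => .or (g _ a) (g _ b)
  | _, .not a => .not (g _ a)
  | _, .get A ix => .get (g _ A) (fun i => g _ (ix i))
  | _, .set A ix e => .set (g _ A) (fun i => g _ (ix i)) (g _ e)
  | _, .phi brs els => .phi (brs.map fun p => (g _ p.1, g _ p.2)) (g _ els)
  | _, .loopPhi init brs els =>
      .loopPhi (g _ init) (brs.map fun p => (g _ p.1, g _ p.2)) (g _ els)
  | _, .loopcall args => .loopcall (fun σ s => g σ (args σ s))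

/-- `o.Uses w`: the vertex `w` is an operand of `o`. -/
def Uses : {τ : Ty} → Op d I J V τ → (Σ σ, V σ) → Prop
  | _, .input _, _ => False
  | _, .ilit _, _ => False
  | _, .nlit _, _ => False
  | _, .blit _, _ => False
  | _, .bound b s, w => w = ⟨_, b⟩ ∨ w = ⟨_, s⟩
  | _, .ineg a, w => w = ⟨_, a⟩
  | _, .iop _ a b, w => w = ⟨_, a⟩ ∨ w = ⟨_, b⟩
  | _, .nop1 _ a, w => w = ⟨_, a⟩
  | _, .nop2 _ a b, w => w = ⟨_, a⟩ ∨ w = ⟨_, b⟩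
  | _, .cmp _ a b, w => w = ⟨_, a⟩ ∨ w = ⟨_, b⟩
  | _, .and a b, w => w = ⟨_, a⟩ ∨ w = ⟨_, b⟩
  | _, .or a b, w => w = ⟨_, a⟩ ∨ w = ⟨_, b⟩
  | _, .not a, w => w = ⟨_, a⟩
  | _, .get A ix, w => w = ⟨_, A⟩ ∨ ∃ i, w = ⟨_, ix i⟩
  | _, .set A ix e, w => w = ⟨_, A⟩ ∨ (∃ i, w = ⟨_, ix i⟩) ∨ w = ⟨_, e⟩
  | _, .phi brs els, w => (∃ p ∈ brs, w = ⟨_, p.1⟩ ∨ w = ⟨_, p.2⟩) ∨ w = ⟨_, els⟩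
  | _, .loopPhi init brs els, w =>
      w = ⟨_, init⟩ ∨ (∃ p ∈ brs, w = ⟨_, p.1⟩ ∨ w = ⟨_, p.2⟩) ∨ w = ⟨_, els⟩
  | _, .loopcall args, w => ∃ σ s, w = ⟨σ, args σ s⟩

def IsLoopPhi {τ : Ty} (o : Op d I J V τ) : Prop := ∃ init brs els, o = .loopPhi init brs els

def IsInput {τ : Ty} (o : Op d I J V τ) : Prop := ∃ s, o = .input s

def IsLoopcall : {τ : Ty} → Op d I J V τ → Prop
  | _, .loopcall _ => True
  | _, _ => False

/-- The function computed by an operation in iteration `n ≥ 1`: `ρ` gives the input symbols, `rd`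
the operands, `call` the effect of the loop one level below. -/
noncomputable def eval (ρ : Env d I) (n : ℤ) (rd : ∀ σ, V σ → Val d σ)
    (call : Env d J → Val d .arr) : {τ : Ty} → Op d I J V τ → Val d τ
  | _, .input s => ρ _ s
  | _, .ilit c => c
  | _, .nlit c => c
  | _, .blit c => c
  | _, .bound b s => rd .idx b + (n - 1) * rd .idx s
  | _, .ineg a => - rd .idx a
  | _, .iop o a b => o.eval (rd _ a) (rd _ b)
  | _, .nop1 o a => o.eval (rd _ a)
  | _, .nop2 o a b => o.eval (rd _ a) (rd _ b)
  | _, .cmp o a b => o.eval (rd _ a) (rd _ b)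
  | _, .and a b => rd .bool a && rd .bool b
  | _, .or a b => rd .bool a || rd .bool b
  | _, .not a => ! rd .bool a
  | _, .get A ix => rd .arr A (fun i => rd _ (ix i))
  | _, .set A ix e => Function.update (rd .arr A) (fun i => rd _ (ix i)) (rd _ e)
  | τ, .phi brs els => brs.foldr (fun p r => bif rd .bool p.1 then rd τ p.2 else r) (rd τ els)
  | τ, .loopPhi _ brs els =>
      brs.foldr (fun p r => bif rd .bool p.1 then rd τ p.2 else r) (rd τ els)
  | _, .loopcall args => call (fun σ s => rd σ (args σ s))

end Op

/-! ## Dependency graphs, loops, kernels -/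

/-- A data dependency graph of one loop level: typed vertices with operations, the number `trip` of
iterations of one execution of the loop, and the `φ` vertex `out` of the output array. There is an
edge from every operand of `op v` to `v`. -/
structure DepGraph (d : ℕ) (I J : Ty → Type) where
  V : Ty → Type
  op : ∀ {τ : Ty}, V τ → Op d I J V τ
  trip : ℕ
  out : V .arr

namespace DepGraph

variable {d : ℕ} {I J : Ty → Type} (G : DepGraph d I J)

abbrev Vert : Type := Σ τ, G.V τ

def Edge (w v : G.Vert) : Prop := (G.op v.2).Uses w

def IsLoopPhi (v : G.Vert) : Prop := (G.op v.2).IsLoopPhi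

def IsLoopcall (v : G.Vert) : Prop := (G.op v.2).IsLoopcall

/-- `u` and `v` lie in the same strongly connected component. -/
def SameSCC (u v : G.Vert) : Prop :=
  Relation.ReflTransGen G.Edge u v ∧ Relation.ReflTransGen G.Edge v u

end DepGraph

/-- The code of a loop: a straight-line body in SSA form (one statement `v := op v` for every
variable `v`, in the order of `body`) that is executed `trip ≥ 1` times. Conditional statements are
encoded by branching conditions and `φ` functions. A loop-carried variable `v`,
`op v = loopPhi init brs els`, is initialized from an input of the loop; when it is read in an
iteration, it has the value from the end of the previous iteration. Every other variable is assigned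
before it is read. -/
structure LoopCode (d : ℕ) (I J : Ty → Type) extends DepGraph d I J where
  body : List toDepGraph.Vert
  body_nodup : body.Nodup
  mem_body : ∀ v, v ∈ body
  def_before_use : ∀ w v, toDepGraph.Edge w v → ¬ toDepGraph.IsLoopPhi w →
    ∃ l₁ l₂, body = l₁ ++ v :: l₂ ∧ w ∈ l₁
  init_input : ∀ {τ : Ty} (v init : V τ) brs els,
    op v = .loopPhi init brs els → (op init).IsInput
  trip_pos : 1 ≤ trip
  out_phi : (op out).IsLoopPhi

namespace LoopCode

open Classical in
/-- One iteration, the `n`-th one: the statements of the body are executed in order. `prev` is the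
store at the end of the previous iteration. -/
noncomputable def iterate {d : ℕ} {I J : Ty → Type} (L : LoopCode d I J) (ρ : Env d I)
    (call : Env d J → Val d .arr) (n : ℤ) (prev : ∀ v : L.Vert, Val d v.1) :
    ∀ v : L.Vert, Val d v.1 :=
  L.body.foldl
    (fun cur v => Function.update cur v
      ((L.op v.2).eval ρ n
        (fun σ w => if L.IsLoopPhi ⟨σ, w⟩ then prev ⟨σ, w⟩ else cur ⟨σ, w⟩) call))
    prev

/-- The store at loop entry: loop-carried variables are initialized. -/
noncomputable def entry {d : ℕ} {I J : Ty → Type} (L : LoopCode d I J) (ρ : Env d I)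
    (call : Env d J → Val d .arr) (v : L.Vert) : Val d v.1 :=
  match L.op v.2 with
  | .loopPhi init _ _ => (L.op init).eval ρ 0 (fun σ _ => Val.dflt d σ) call
  | _ => Val.dflt d v.1

/-- The store after `n` iterations. -/
noncomputable def state {d : ℕ} {I J : Ty → Type} (L : LoopCode d I J) (ρ : Env d I)
    (call : Env d J → Val d .arr) : ℕ → ∀ v : L.Vert, Val d v.1
  | 0 => L.entry ρ call
  | n + 1 => L.iterate ρ call (n + 1) (L.state ρ call n)

/-- A complete execution of the loop, as a function from its inputs to the output array. -/
noncomputable def run {d : ℕ} {I J : Ty → Type} (L : LoopCode d I J)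
    (call : Env d J → Val d .arr) (ρ : Env d I) : Val d .arr :=
  L.state ρ call L.trip ⟨.arr, L.out⟩

open Classical in
/-- The number of `Loopcall` statements in the body. -/
noncomputable def callCount {d : ℕ} {I J : Ty → Type} (L : LoopCode d I J) : ℕ :=
  (L.body.filter fun v => L.IsLoopcall v).length

end LoopCode

/-- A stencil kernel: a nested loop of `k` levels whose outermost loop has the inputs `I`. The
innermost loop calls no loop; every other loop calls the loop one level below. -/
inductive Kernel (d : ℕ) : (Ty → Type) → ℕ → Type 1
  | base {I : Ty → Type} (L : LoopCode d I fun _ => Empty) (h : ∀ v, ¬ L.IsLoopcall v) :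
      Kernel d I 1
  | nest {I J : Ty → Type} {k : ℕ} (L : LoopCode d I J) (inner : Kernel d J k)
      (h : ∃ v, L.IsLoopcall v) : Kernel d I (k + 1)

/-- Execution of a kernel: the final output array as a function of the inputs. -/
noncomputable def Kernel.exec {d : ℕ} : {I : Ty → Type} → {k : ℕ} → Kernel d I k →
    Env d I → Val d .arr
  | _, _, .base L _ => L.run (fun _ => Val.dflt d .arr)
  | _, _, .nest L inner _ => L.run inner.exec

/-! ## The SSA-based multilevel graph and the invariant graph -/

/-- A vertex of the SSA-based multilevel graph at one level: the instance of the variable `var` in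
iteration `iter` of the invocation number `call` of the loop. Iteration `0` is loop entry. -/
structure Inst (V : Ty → Type) (τ : Ty) where
  call : ℕ
  iter : ℕ
  var : V τ

open Classical in
/-- The operation of a vertex of the SSA-based multilevel graph: its operands (predecessors) are
instances in the same loop slice, or, for a loop-carried variable, in the preceding one. -/
noncomputable def LoopCode.smgOp {d : ℕ} {I J : Ty → Type} (L : LoopCode d I J) {τ : Ty}
    (w : Inst L.V τ) : Op d I J (Inst L.V) τ :=
  (L.op w.var).map fun σ u =>
    ⟨w.call, if L.IsLoopPhi ⟨σ, u⟩ then w.iter - 1 else w.iter, u⟩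

/-- `G` is an invariant subgraph of the loop `L`, which is invoked `M` times: a map `f` from the
vertices of the multilevel graph at this level to the vertices of `G` restricts to a bijection on
every loop slice and preserves the operations, the edges within a loop slice and the edges between
slices. -/
def IsInvariantSubgraph {d : ℕ} {I J : Ty → Type} (M : ℕ) (L : LoopCode d I J)
    (G : DepGraph d I J) : Prop :=
  G.trip = L.trip ∧ ∃ f : ∀ τ, Inst L.V τ → G.V τ,
    ∀ m, 1 ≤ m → m ≤ M →
      (∀ n, 1 ≤ n → n ≤ L.trip →
        (∀ τ, Function.Bijective fun v : L.V τ => f τ ⟨m, n, v⟩) ∧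
        (∀ τ (v : L.V τ), G.op (f τ ⟨m, n, v⟩) = (L.smgOp ⟨m, n, v⟩).map f) ∧
        f .arr ⟨m, n, L.out⟩ = G.out) ∧
      ∀ τ (v : L.V τ), L.IsLoopPhi ⟨τ, v⟩ → f τ ⟨m, 0, v⟩ = f τ ⟨m, 1, v⟩

/-- Graphs with one subgraph per loop level. The edges between adjacent levels connect every actual
argument of a `Loopcall` vertex with the input vertices of its dual formal parameter, and the output
vertex of the lower level with the `Loopcall` vertex. -/
inductive MultiGraph (d : ℕ) : (Ty → Type) → ℕ → Type 1
  | base {I : Ty → Type} (G : DepGraph d I fun _ => Empty) : MultiGraph d I 1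
  | nest {I J : Ty → Type} {k : ℕ} (G : DepGraph d I J) (inner : MultiGraph d J k) :
      MultiGraph d I (k + 1)

/-- `IsInvariantGraph M P g`: `g` is an invariant graph of the kernel `P`, the outermost loop of
which is invoked `M` times. -/
inductive IsInvariantGraph {d : ℕ} : {I : Ty → Type} → {k : ℕ} → ℕ → Kernel d I k →
    MultiGraph d I k → Prop
  | base {I : Ty → Type} {M : ℕ} {L : LoopCode d I fun _ => Empty} {h : ∀ v, ¬ L.IsLoopcall v}
      {G : DepGraph d I fun _ => Empty} (hG : IsInvariantSubgraph M L G) :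
      IsInvariantGraph M (.base L h) (.base G)
  | nest {I J : Ty → Type} {k M : ℕ} {L : LoopCode d I J} {P : Kernel d J k}
      {h : ∃ v, L.IsLoopcall v} {G : DepGraph d I J} {g : MultiGraph d J k}
      (hG : IsInvariantSubgraph M L G) (hg : IsInvariantGraph (M * L.trip * L.callCount) P g) :
      IsInvariantGraph M (.nest L P h) (.nest G g)

/-- At every level, each strongly connected component has at most one loop-carried `φ` vertex. -/
def MultiGraph.SingleCarried {d : ℕ} : {I : Ty → Type} → {k : ℕ} → MultiGraph d I k → Prop
  | _, _, .base G => ∀ u v, G.IsLoopPhi u → G.IsLoopPhi v → G.SameSCC u v → u = v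
  | _, _, .nest G inner =>
      (∀ u v, G.IsLoopPhi u → G.IsLoopPhi v → G.SameSCC u v → u = v) ∧ inner.SingleCarried

/-! ## Summaries -/

/-- Quantifier-free symbolic expressions over the input symbols `I`, the iteration number `iter`
of the current loop and the array position `pos 0, …, pos (d - 1)`. -/
inductive SExp (d : ℕ) (I : Ty → Type) : Ty → Type
  | isym (s : I .idx) : SExp d I .idx
  | nsym (s : I .num) : SExp d I .num
  | bsym (s : I .bool) : SExp d I .bool
  | iter : SExp d I .idx
  | pos (i : Fin d) : SExp d I .idx
  | ilit (c : ℤ) : SExp d I .idx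
  | nlit (c : ℝ) : SExp d I .num
  | blit (c : Bool) : SExp d I .bool
  | ineg (a : SExp d I .idx) : SExp d I .idx
  | iop (o : IdxOp) (a b : SExp d I .idx) : SExp d I .idx
  | nop1 (o : NumOp1) (a : SExp d I .num) : SExp d I .num
  | nop2 (o : NumOp2) (a b : SExp d I .num) : SExp d I .num
  | cmp (o : CmpOp) (a b : SExp d I .idx) : SExp d I .bool
  | and (a b : SExp d I .bool) : SExp d I .bool
  | or (a b : SExp d I .bool) : SExp d I .bool
  | not (a : SExp d I .bool) : SExp d I .bool
  | get (A : I .arr) (ix : Fin d → SExp d I .idx) : SExp d I .num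
  | ite {τ : Ty} (c : SExp d I .bool) (a b : SExp d I τ) : SExp d I τ

namespace SExp

variable {d : ℕ} {I J : Ty → Type}

/-- The value of an expression, for given values of the input symbols, of the iteration number and
of the position. -/
noncomputable def eval (ρ : Env d I) (n : ℤ) (x : Fin d → ℤ) :
    {τ : Ty} → SExp d I τ → Val d τ
  | _, .isym s => ρ .idx s
  | _, .nsym s => ρ .num s
  | _, .bsym s => ρ .bool s
  | _, .iter => n
  | _, .pos i => x i
  | _, .ilit c => c
  | _, .nlit c => c
  | _, .blit c => c
  | _, .ineg a => - (eval ρ n x a : ℤ)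
  | _, .iop o a b => o.eval (eval ρ n x a) (eval ρ n x b)
  | _, .nop1 o a => o.eval (eval ρ n x a)
  | _, .nop2 o a b => o.eval (eval ρ n x a) (eval ρ n x b)
  | _, .cmp o a b => o.eval (eval ρ n x a) (eval ρ n x b)
  | _, .and a b => (eval ρ n x a : Bool) && (eval ρ n x b : Bool)
  | _, .or a b => (eval ρ n x a : Bool) || (eval ρ n x b : Bool)
  | _, .not a => ! (eval ρ n x a : Bool)
  | _, .get A ix => ρ .arr A (fun i => eval ρ n x (ix i))
  | _, .ite c a b => bif (eval ρ n x c : Bool) then eval ρ n x a else eval ρ n x b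

/-- Replace the iteration number by `t` and the position by `p`. -/
def inst (t : SExp d I .idx) (p : Fin d → SExp d I .idx) : {τ : Ty} → SExp d I τ → SExp d I τ
  | _, .isym s => .isym s
  | _, .nsym s => .nsym s
  | _, .bsym s => .bsym s
  | _, .iter => t
  | _, .pos i => p i
  | _, .ilit c => .ilit c
  | _, .nlit c => .nlit c
  | _, .blit c => .blit c
  | _, .ineg a => .ineg (inst t p a)
  | _, .iop o a b => .iop o (inst t p a) (inst t p b)
  | _, .nop1 o a => .nop1 o (inst t p a)
  | _, .nop2 o a b => .nop2 o (inst t p a) (inst t p b)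
  | _, .cmp o a b => .cmp o (inst t p a) (inst t p b)
  | _, .and a b => .and (inst t p a) (inst t p b)
  | _, .or a b => .or (inst t p a) (inst t p b)
  | _, .not a => .not (inst t p a)
  | _, .get A ix => .get A (fun i => inst t p (ix i))
  | _, .ite c a b => .ite (inst t p c) (inst t p a) (inst t p b)

/-- The symbol `s`; for an array symbol, its element at the current position. -/
def ofSym : {τ : Ty} → I τ → SExp d I τ.elem
  | .idx, s => .isym s
  | .num, s => .nsym s
  | .bool, s => .bsym s
  | .arr, s => .get s .pos

/-- Replace every input symbol `s` by `σ s`, where `σ s` is the element at the current position if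
`s` is an array symbol. -/
def subst (σ : ∀ τ, J τ → SExp d I τ.elem) : {τ : Ty} → SExp d J τ → SExp d I τ
  | _, .isym s => σ .idx s
  | _, .nsym s => σ .num s
  | _, .bsym s => σ .bool s
  | _, .iter => .iter
  | _, .pos i => .pos i
  | _, .ilit c => .ilit c
  | _, .nlit c => .nlit c
  | _, .blit c => .blit c
  | _, .ineg a => .ineg (subst σ a)
  | _, .iop o a b => .iop o (subst σ a) (subst σ b)
  | _, .nop1 o a => .nop1 o (subst σ a)
  | _, .nop2 o a b => .nop2 o (subst σ a) (subst σ b)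
  | _, .cmp o a b => .cmp o (subst σ a) (subst σ b)
  | _, .and a b => .and (subst σ a) (subst σ b)
  | _, .or a b => .or (subst σ a) (subst σ b)
  | _, .not a => .not (subst σ a)
  | _, .get A ix => inst .iter (fun i => subst σ (ix i)) (σ .arr A)
  | _, .ite c a b => .ite (subst σ c) (subst σ a) (subst σ b)

/-- The condition that the current position is `ix`. -/
def posEq (ix : Fin d → SExp d I .idx) : SExp d I .bool :=
  (List.finRange d).foldr (fun i c => .and (.cmp .eq (.pos i) (ix i)) c) (.blit true)

/-- Disjunction of a list of conditions. -/
def disj (l : List (SExp d I .bool)) : SExp d I .bool := l.foldr .or (.blit false)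

end SExp

/-- The summary of a vertex of type `τ`: guarded branches that end in element expressions. For an
array, a branch describes the element at the current position. `inp s` stands for the input `s`.
`keep s` stands for the input `s`, too; it is the final branch in the summaries computed from a
start vertex that is initialized from `s`, for the case that no update has taken place. -/
inductive Summary (d : ℕ) (I : Ty → Type) (τ : Ty) : Type
  | elem (e : SExp d I τ.elem) : Summary d I τ
  | inp (s : I τ) : Summary d I τ
  | keep (s : I τ) : Summary d I τ
  | ite (c : SExp d I .bool) (a b : Summary d I τ) : Summary d I τ

namespace Summary

variable {d : ℕ} {I J : Ty → Type} {τ : Ty}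

def toExp : Summary d I τ → SExp d I τ.elem
  | .elem e => e
  | .inp s => .ofSym s
  | .keep s => .ofSym s
  | .ite c a b => .ite c a.toExp b.toExp

/-- The value of a summary (for an array, of the element at position `x`). -/
noncomputable def eval (ρ : Env d I) (n : ℤ) (x : Fin d → ℤ) (S : Summary d I τ) :
    Val d τ.elem :=
  S.toExp.eval ρ n x

/-- Replace the iteration number by `t`. -/
def at_ (t : SExp d I .idx) : Summary d I τ → Summary d I τ
  | .elem e => .elem (SExp.inst t .pos e)
  | .inp s => .inp s
  | .keep s => .keep s
  | .ite c a b => .ite (SExp.inst t .pos c) (at_ t a) (at_ t b)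

/-- The time-shifted summary: the iteration number `t` becomes `t - 1`. -/
def shift (S : Summary d I τ) : Summary d I τ := S.at_ (.iop .sub .iter (.ilit 1))

/-- Turn inputs into final branches. -/
def mark : Summary d I τ → Summary d I τ
  | .elem e => .elem e
  | .inp s => .keep s
  | .keep s => .keep s
  | .ite c a b => .ite c a.mark b.mark

/-- Turn final branches into inputs. -/
def seal_ : Summary d I τ → Summary d I τ
  | .elem e => .elem e
  | .inp s => .inp s
  | .keep s => .inp s
  | .ite c a b => .ite c a.seal_ b.seal_

/-- Replace every input symbol `s` by the summary `σ s`. -/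
def subst (σ : ∀ τ, J τ → Summary d I τ) : Summary d J τ → Summary d I τ
  | .elem e => .elem (e.subst fun τ s => (σ τ s).toExp)
  | .inp s => σ τ s
  | .keep s => σ τ s
  | .ite c a b => .ite (c.subst fun τ s => (σ τ s).toExp) (subst σ a) (subst σ b)

/-- The pairs `(P, E)` of validity condition and expression, without the final branch. -/
def branches : Summary d I τ → List (SExp d I .bool × SExp d I τ.elem)
  | .elem e => [(.blit true, e)]
  | .inp s => [(.blit true, .ofSym s)]
  | .keep _ => []
  | .ite c a b =>
      a.branches.map (fun q => (.and c q.1, q.2)) ++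
      b.branches.map (fun q => (.and (.not c) q.1, q.2))

/-- Generalization of a summary with the branches `(P_k, E_k)` and the final branch `hat`, for a
loop with the iterations `1, …, N`. A branch `E_k` that has been generalized from iteration `t₁`
applies in iteration `t` to the positions that were last updated by `E_k`, in iteration `t₁`:
`t₁ ≤ t ∧ P_k(x, t₁) ∧ ¬ ∃ t₂, t₁ < t₂ ∧ t₂ ≤ t ∧ P(x, t₂)`, where `P = ⋁ₖ P_k`.
The quantifier over the iterations is eliminated by expansion; the expressions and the `P_k` are
instantiated at `t₁`, so that the generalized expressions do not depend on `t`. -/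
def generalize (N : ℕ) (hat S : Summary d I τ) : Summary d I τ :=
  let P : ℕ → SExp d I .bool := fun t₂ =>
    SExp.inst (.ilit t₂) .pos (SExp.disj (S.branches.map Prod.fst))
  let upTo : ℕ → SExp d I .bool := fun t' => .cmp .le (.ilit t') .iter
  let gen : List (SExp d I .bool × SExp d I τ.elem) :=
    S.branches.flatMap fun q =>
      (List.range' 1 N).map fun t₁ =>
        (.and (.and (upTo t₁) (SExp.inst (.ilit t₁) .pos q.1))
          (.not (SExp.disj
            ((List.range' (t₁ + 1) (N - t₁)).map fun t₂ => .and (upTo t₂) (P t₂)))),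
         SExp.inst (.ilit t₁) .pos q.2)
  gen.foldr (fun q S' => .ite q.1 (.elem q.2) S') hat

/-- Logical equivalence of two summaries over the iterations `1, …, N`. -/
def Equiv (N : ℕ) (S T : Summary d I τ) : Prop :=
  ∀ (ρ : Env d I) (n : ℤ) (x : Fin d → ℤ), 1 ≤ n → n ≤ N → S.eval ρ n x = T.eval ρ n x

end Summary

/-- The summary rules: the summary of a vertex with the given operation, from the summaries `rd` of
its operands and (for a `Loopcall`) the postcondition `post` of the loop one level below, where the
summaries of the actual arguments are substituted for the formal parameters. -/
def Op.rule {d : ℕ} {I J V : Ty → Type} (rd : ∀ σ, V σ → Summary d I σ)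
    (post : Summary d J .arr) : {τ : Ty} → Op d I J V τ → Summary d I τ
  | _, .input s => .inp s
  | _, .ilit c => .elem (.ilit c)
  | _, .nlit c => .elem (.nlit c)
  | _, .blit c => .elem (.blit c)
  | _, .bound b s =>
      .elem (.iop .add (rd .idx b).toExp
        (.iop .mul (.iop .sub .iter (.ilit 1)) (rd .idx s).toExp))
  | _, .ineg a => .elem (.ineg (rd .idx a).toExp)
  | _, .iop o a b => .elem (.iop o (rd .idx a).toExp (rd .idx b).toExp)
  | _, .nop1 o a => .elem (.nop1 o (rd .num a).toExp)
  | _, .nop2 o a b => .elem (.nop2 o (rd .num a).toExp (rd .num b).toExp)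
  | _, .cmp o a b => .elem (.cmp o (rd .idx a).toExp (rd .idx b).toExp)
  | _, .and a b => .elem (.and (rd .bool a).toExp (rd .bool b).toExp)
  | _, .or a b => .elem (.or (rd .bool a).toExp (rd .bool b).toExp)
  | _, .not a => .elem (.not (rd .bool a).toExp)
  | _, .get A ix => .elem (SExp.inst .iter (fun i => (rd .idx (ix i)).toExp) (rd .arr A).toExp)
  | _, .set A ix e =>
      .ite (.posEq fun i => (rd .idx (ix i)).toExp) (.elem (rd .num e).toExp) (rd .arr A)
  | τ, .phi brs els =>
      brs.foldr (fun p r => .ite (rd .bool p.1).toExp (rd τ p.2) r) (rd τ els)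
  | τ, .loopPhi _ brs els =>
      brs.foldr (fun p r => .ite (rd .bool p.1).toExp (rd τ p.2) r) (rd τ els)
  | _, .loopcall args => post.subst fun σ s => rd σ (args σ s)

/-! ## The hierarchical recursive lifting algorithm -/

namespace DepGraph

variable {d : ℕ} {I J : Ty → Type} (G : DepGraph d I J)

/-- The tensor that stores the summaries of the vertices. -/
abbrev Tensor : Type := ∀ v : G.Vert, Summary d I v.1

/-- The working data at one level: the summaries, and the postconditions that have been obtained
for the `Loopcall` vertices. -/
structure Store where
  S : G.Tensor
  post : G.Vert → Summary d J .arr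

/-- A component is trivial if it is a single vertex that is not on a cycle. -/
def Trivial (c : List G.Vert) : Prop := ∃ v, c = [v] ∧ ¬ G.Edge v v

/-- The components in priority order. Every component is listed in the order in which it is swept,
the start vertex of a nontrivial component comes last. -/
structure IsSequence (Ω : List (List G.Vert)) : Prop where
  isSCC : ∀ c ∈ Ω, ∃ v, ∀ w, w ∈ c ↔ G.SameSCC v w
  cover : ∀ v, v ∈ Ω.flatten
  nodup : Ω.flatten.Nodup
  topological : Ω.Pairwise fun c c' => ∀ u ∈ c, ∀ v ∈ c', ¬ G.Edge v u
  sweep : ∀ c ∈ Ω, ¬ G.Trivial c → ∃ l start, c = l ++ [start] ∧ G.IsLoopPhi start ∧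
    l.Pairwise fun a b => ¬ G.Edge b a

open Classical in
/-- The summary of the operand `w` that is available in the current iteration. A loop-carried
variable has the value from the previous iteration, the initial one in iteration `1`; the tensor
already holds this time-shifted summary for the start vertex of the current sweep. -/
noncomputable def read (start : Option G.Vert) (S : G.Tensor) (σ : Ty) (w : G.V σ) :
    Summary d I σ :=
  match G.op w with
  | .loopPhi init _ _ =>
      if start = some ⟨σ, w⟩ then S ⟨σ, w⟩
      else .ite (.cmp .eq .iter (.ilit 1)) (S ⟨σ, init⟩) (S ⟨σ, w⟩).shift
  | _ => S ⟨σ, w⟩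

open Classical in
/-- Apply the summary rule of the vertex `v`. -/
noncomputable def applyRule (start : Option G.Vert) (post : G.Vert → Summary d J .arr)
    (S : G.Tensor) (v : G.Vert) : G.Tensor :=
  Function.update S v ((G.op v.2).rule (G.read start S) (post v))

/-- A forward sweep over the component `c`. -/
noncomputable def forwardSweep (start : G.Vert) (post : G.Vert → Summary d J .arr)
    (c : List G.Vert) (S : G.Tensor) : G.Tensor :=
  c.foldl (G.applyRule (some start) post) S

open Classical in
/-- The repeat-until loop of the iterative semantic extraction; `none` if the exit condition has not
been met after `budget` rounds. `hat` is the initial summary of the start vertex. -/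
noncomputable def repeatUntil (start : G.Vert) (hat : Summary d I start.1)
    (post : G.Vert → Summary d J .arr) (c : List G.Vert) : (budget : ℕ) → G.Tensor →
    Option G.Tensor
  | 0, _ => none
  | budget + 1, S =>
      let general := Summary.generalize G.trip hat (S start)
      let S' := G.forwardSweep start post c (Function.update S start general.shift)
      if Summary.Equiv G.trip (S' start) general then some S'
      else repeatUntil start hat post c budget S'

open Classical in
/-- Iterative semantic extraction within the component `c`. -/
noncomputable def extract (budget : ℕ) (post : G.Vert → Summary d J .arr) (c : List G.Vert)
    (S : G.Tensor) : Option G.Tensor :=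
  match c.getLast? with
  | none => some S
  | some start =>
      if G.Trivial c then some (G.applyRule none post S start)
      else
        match G.op start.2 with
        | .loopPhi init _ _ =>
            let hat := (S ⟨start.1, init⟩).mark
            let S₁ := G.forwardSweep start post c (Function.update S start hat)
            (G.repeatUntil start hat post c budget S₁).map fun S' v => (S' v).seal_
        | _ => none

open Classical in
/-- Initialization of the summaries of all `Loopcall` vertices of the component `c`. `callee` is the
result of the recursive call. -/
noncomputable def initLoopcalls (callee : Option (Summary d J .arr)) (c : List G.Vert)
    (st : G.Store) : Option G.Store :=
  c.foldlM (fun st v =>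
    if G.IsLoopcall v then
      callee.map fun post =>
        let posts := Function.update st.post v post
        { S := G.applyRule none posts st.S v, post := posts }
    else some st) st

/-- The algorithm at one level. `Ω` is the sequence of the strongly connected components, `S₀` the
tensor on entry, and `callee` the result of the algorithm on the next lower level. The returned
summary is that of the output vertex after the last iteration. -/
noncomputable def liftLevel (budget : ℕ) (callee : Option (Summary d J .arr))
    (Ω : List (List G.Vert)) (S₀ : G.Tensor) : Option (Summary d I .arr) :=
  let S₁ : G.Tensor := fun v =>
    match G.op v.2 with
    | .input s => .inp s
    | _ => S₀ v
  let st₁ : G.Store := { S := S₁, post := fun _ => .elem (.nlit 0) }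
  (Ω.foldlM (fun (st : G.Store) c => do
      let st' ← G.initLoopcalls callee c st
      let S' ← G.extract budget st'.post c st'.S
      some { S := S', post := st'.post }) st₁).map
    fun st : G.Store => (st.S ⟨.arr, G.out⟩).at_ (.ilit G.trip)

end DepGraph

/-- What the algorithm leaves open at each level: the sequence of the components with their sweep
orders, and the content of the tensor on entry. -/
def Plan {d : ℕ} : {I : Ty → Type} → {k : ℕ} → MultiGraph d I k → Type
  | _, _, .base G => List (List G.Vert) × G.Tensor
  | _, _, .nest G inner => (List (List G.Vert) × G.Tensor) × Plan inner

/-- At every level, the plan lists the strongly connected components in a topological order. -/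
def Plan.Valid {d : ℕ} : {I : Ty → Type} → {k : ℕ} → (g : MultiGraph d I k) → Plan g → Prop
  | _, _, .base G, p => G.IsSequence p.1
  | _, _, .nest G inner, p => G.IsSequence p.1.1 ∧ Plan.Valid inner p.2

/-- Hierarchical recursive lifting, from the outermost level. `budget` limits the number of rounds
of every repeat-until loop; the result is `none` if one of these loops does not end within it. -/
noncomputable def lift {d : ℕ} (budget : ℕ) : {I : Ty → Type} → {k : ℕ} →
    (g : MultiGraph d I k) → Plan g → Option (Summary d I .arr)
  | _, _, .base G, p => G.liftLevel budget none p.1 p.2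
  | _, _, .nest G inner, p => G.liftLevel budget (lift budget inner p.2) p.1.1 p.1.2

/-- The predicate on final states that a summary of the output array expresses, relative to the
inputs `ρ`: every element of the output array `B` has the value given by the summary. -/
def Summary.Holds {d : ℕ} {I : Ty → Type} (S : Summary d I .arr) (ρ : Env d I)
    (B : Val d .arr) : Prop :=
  ∀ (n : ℤ) (x : Fin d → ℤ), B x = S.eval ρ n x

/-- `S` is the summary, or postcondition, of the kernel `P`: it holds after every execution. -/
def IsPostcondition {d : ℕ} {I : Ty → Type} {k : ℕ} (P : Kernel d I k)
    (S : Summary d I .arr) : Prop :=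
  ∀ ρ : Env d I, S.Holds ρ (P.exec ρ)

end StencilLifting

/-!
The algorithm is correct because the two fixed points that it has to find, one over the iterations
of a loop and one over the rounds of a repeat-until loop, are both reached along the iterations.

*Values.* An execution of a loop is a solution of the equations of its dependency graph, in which a
loop-carried variable is read from the previous iteration (`LoopCode.isTrace_state`). These equations
carry over to the invariant graph (`IsInvariantSubgraph.exists_isTrace`), although the bijections
between the loop slices and the graph may vary with the iteration. The summary rules are sound
(`Op.rule_denotes`), so everything follows along a topological order as long as there is no cycle.

*Cycles.* On a component with one loop-carried variable, a forward sweep computes the summaries in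
iteration `n` from the summary of the start vertex in the same iteration (`forwardSweep_agree`,
`forwardSweep_denotes`); after the time shift this is the generalized summary in iteration `n - 1`,
which in turn depends on the iterations `1, …, n - 1` of the previous round only
(`Summary.Agree.generalize`). In iteration `0` it is the initial value. Therefore, if the exit
condition holds, the generalized summary is correct, by induction on the iteration
(`round_denotes`).

*Termination.* By the same dependency, every round settles one more iteration: its summary is not
changed by later rounds (`Settled.succ`). When all `N` iterations have settled, the exit condition
holds (`Settled.equiv`), hence `N + 1` rounds suffice for all inputs. What has to be watched besides
the values is which positions still keep their initial value (`Summary.kept`), as the generalization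
distinguishes these from positions that have been overwritten with an equal value. The set of these
positions can only shrink from one iteration to the next, so that a position kept in iteration `t`
has not been updated in `1, …, t`, and generalizing a settled summary does not change it.

*Orders.* Sorting the components by their number of ancestors gives a topological order. Within a
component, all edges but those out of the loop-carried variable increase the position in the loop
body, so that sorting by this position and moving the start vertex to the end gives a sweep order
(`exists_isSequence`).
-/

namespace StencilLifting

/-! ### Values of expressions and summaries -/

/-- The element of a value at a position; a scalar is its own element everywhere. -/
def Val.elemAt {d : ℕ} : {τ : Ty} → Val d τ → (Fin d → ℤ) → Val d τ.elem
  | .idx, v, _ => v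
  | .num, v, _ => v
  | .bool, v, _ => v
  | .arr, v, x => v x

namespace SExp

variable {d : ℕ} {I J : Ty → Type}

theorem eval_inst (ρ : Env d I) (n : ℤ) (x : Fin d → ℤ) (t : SExp d I .idx)
    (p : Fin d → SExp d I .idx) {τ : Ty} (e : SExp d I τ) :
    (inst t p e).eval ρ n x = e.eval ρ (t.eval ρ n x) (fun i => (p i).eval ρ n x) := by
  induction e <;> simp_all [inst, eval]

theorem eval_ofSym (ρ : Env d I) (n : ℤ) (x : Fin d → ℤ) {τ : Ty} (s : I τ) :
    (ofSym s : SExp d I τ.elem).eval ρ n x = (ρ τ s).elemAt x := by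
  cases τ <;> rfl

/-- Only the values of the substituted expressions in the current iteration matter. -/
theorem eval_subst_congr {ρ : Env d I} {n : ℤ} {σ σ' : ∀ τ, J τ → SExp d I τ.elem}
    (h : ∀ τ s x, (σ τ s).eval ρ n x = (σ' τ s).eval ρ n x) {τ : Ty} (e : SExp d J τ)
    (x : Fin d → ℤ) : (e.subst σ).eval ρ n x = (e.subst σ').eval ρ n x := by
  induction e <;> simp_all [subst, eval, eval_inst]

/-- Substitution lemma: substituting expressions amounts to evaluating in their values. -/
theorem eval_subst {ρ : Env d I} {ρ' : Env d J} {n : ℤ} {σ : ∀ τ, J τ → SExp d I τ.elem}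
    (h : ∀ τ s x, (σ τ s).eval ρ n x = (ρ' τ s).elemAt x) {τ : Ty} (e : SExp d J τ)
    (x : Fin d → ℤ) : (e.subst σ).eval ρ n x = e.eval ρ' n x := by
  induction e <;> simp_all [subst, eval, eval_inst] <;> first | exact h _ _ _ | rfl

theorem eval_eq (ρ : Env d I) (n : ℤ) (x : Fin d → ℤ) (a b : SExp d I .idx) :
    (cmp .eq a b).eval ρ n x = true ↔ a.eval ρ n x = b.eval ρ n x :=
  decide_eq_true_iff

theorem eval_le (ρ : Env d I) (n : ℤ) (x : Fin d → ℤ) (a b : SExp d I .idx) :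
    (cmp .le a b).eval ρ n x = true ↔ a.eval ρ n x ≤ b.eval ρ n x :=
  decide_eq_true_iff

theorem eval_and (ρ : Env d I) (n : ℤ) (x : Fin d → ℤ) (a b : SExp d I .bool) :
    (a.and b).eval ρ n x = true ↔ a.eval ρ n x = true ∧ b.eval ρ n x = true :=
  Bool.and_eq_true_iff

theorem eval_not (ρ : Env d I) (n : ℤ) (x : Fin d → ℤ) (a : SExp d I .bool) :
    a.not.eval ρ n x = true ↔ ¬ a.eval ρ n x = true := by
  simp [eval]

theorem eval_posEq (ρ : Env d I) (n : ℤ) (x : Fin d → ℤ) (ix : Fin d → SExp d I .idx) :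
    (posEq ix).eval ρ n x = decide (x = fun i => (ix i).eval ρ n x) := by
  have key : ∀ l : List (Fin d),
      (l.foldr (fun i c => SExp.and (.cmp .eq (.pos i) (ix i)) c) (.blit true)).eval ρ n x =
        decide (∀ i ∈ l, x i = (ix i).eval ρ n x) := by
    intro l
    induction l with
    | nil => simp [eval]
    | cons a l ih =>
      rw [Bool.eq_iff_iff, List.foldr_cons, eval_and, ih, eval_eq]
      simp [eval]
  rw [posEq, key]
  simp [funext_iff]

theorem eval_disj (ρ : Env d I) (n : ℤ) (x : Fin d → ℤ) (l : List (SExp d I .bool)) :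
    (disj l).eval ρ n x = true ↔ ∃ c ∈ l, c.eval ρ n x = true := by
  induction l with
  | nil => simp [disj, eval]
  | cons a l ih =>
    rw [disj, List.foldr_cons, ← disj]
    simp [eval, ih]

end SExp

namespace Summary

variable {d : ℕ} {I J : Ty → Type} {τ : Ty}

/-- In iteration `n`, the summary has the value `v`, at every position. -/
def Denotes (S : Summary d I τ) (ρ : Env d I) (n : ℤ) (v : Val d τ) : Prop :=
  ∀ x, S.eval ρ n x = v.elemAt x

/-- The initial value that a summary keeps at a position: the input symbol (with its type) of the
final branch `keep` if this is the branch that applies, and `none` if an update applies. -/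
noncomputable def kept (ρ : Env d I) (n : ℤ) (x : Fin d → ℤ) :
    Summary d I τ → Option (Σ σ, I σ)
  | .elem _ => none
  | .inp _ => none
  | .keep s => some ⟨τ, s⟩
  | .ite c a b => bif (c.eval ρ n x : Bool) then a.kept ρ n x else b.kept ρ n x

/-- Two summaries agree in iteration `n`: they have the same value everywhere, and they keep the
initial value at the same positions. -/
def Agree (S T : Summary d I τ) (ρ : Env d I) (n : ℤ) : Prop :=
  ∀ x, S.eval ρ n x = T.eval ρ n x ∧ S.kept ρ n x = T.kept ρ n x

theorem Agree.refl (S : Summary d I τ) (ρ : Env d I) (n : ℤ) : S.Agree S ρ n :=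
  fun _ => ⟨rfl, rfl⟩

section
variable (ρ : Env d I) (n : ℤ) (x : Fin d → ℤ)

@[simp] theorem eval_elem (e : SExp d I τ.elem) : (elem e).eval ρ n x = e.eval ρ n x := rfl

@[simp] theorem eval_inp (s : I τ) : (inp s : Summary d I τ).eval ρ n x = (ρ τ s).elemAt x :=
  SExp.eval_ofSym ρ n x s

@[simp] theorem eval_keep (s : I τ) : (keep s : Summary d I τ).eval ρ n x = (ρ τ s).elemAt x :=
  SExp.eval_ofSym ρ n x s

@[simp] theorem eval_ite (c : SExp d I .bool) (a b : Summary d I τ) :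
    (ite c a b).eval ρ n x = bif (c.eval ρ n x : Bool) then a.eval ρ n x else b.eval ρ n x := rfl

theorem toExp_eval (S : Summary d I τ) : S.toExp.eval ρ n x = S.eval ρ n x := rfl

theorem eval_at_ (t : SExp d I .idx)
    (S : Summary d I τ) : (S.at_ t).eval ρ n x = S.eval ρ (t.eval ρ n x) x := by
  induction S with
  | elem e => simp [at_, SExp.eval_inst, SExp.eval]
  | inp s => simp [at_]
  | keep s => simp [at_]
  | ite c a b iha ihb => simp [at_, SExp.eval_inst, SExp.eval, iha, ihb]

theorem kept_at_ (t : SExp d I .idx) (S : Summary d I τ) :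
    (S.at_ t).kept ρ n x = S.kept ρ (t.eval ρ n x) x := by
  induction S with
  | elem e => rfl
  | inp s => rfl
  | keep s => rfl
  | ite c a b iha ihb => simp [at_, kept, SExp.eval_inst, SExp.eval, iha, ihb]

@[simp] theorem eval_shift (S : Summary d I τ) : S.shift.eval ρ n x = S.eval ρ (n - 1) x :=
  eval_at_ ρ n x _ S

@[simp] theorem kept_shift (S : Summary d I τ) : S.shift.kept ρ n x = S.kept ρ (n - 1) x :=
  kept_at_ ρ n x _ S

@[simp] theorem eval_seal (S : Summary d I τ) : S.seal_.eval ρ n x = S.eval ρ n x := by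
  induction S with
  | elem e => rfl
  | inp s => rfl
  | keep s => rfl
  | ite c a b iha ihb => simp [seal_, iha, ihb]

@[simp] theorem kept_seal (S : Summary d I τ) : S.seal_.kept ρ n x = none := by
  induction S with
  | elem e => rfl
  | inp s => rfl
  | keep s => rfl
  | ite c a b iha ihb => simp [seal_, kept, iha, ihb]

/-- Where a summary keeps an initial value, it has this value. -/
theorem eval_of_kept {S : Summary d I τ} {s : I τ} (h : S.kept ρ n x = some ⟨τ, s⟩) :
    S.eval ρ n x = (ρ τ s).elemAt x := by
  induction S with
  | elem e => simp [kept] at h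
  | inp s => simp [kept] at h
  | keep s' =>
    simp only [kept, Option.some.injEq, Sigma.mk.injEq, heq_eq_eq, true_and] at h
    simp [h]
  | ite c a b iha ihb =>
    cases hc : (c.eval ρ n x : Bool) <;> simp_all [kept]

end

/-- Substitution lemma for summaries. -/
theorem eval_subst {ρ : Env d I} {ρ' : Env d J} {n : ℤ} {σ : ∀ τ, J τ → Summary d I τ}
    (h : ∀ τ s, (σ τ s).Denotes ρ n (ρ' τ s)) (S : Summary d J τ) (x : Fin d → ℤ) :
    (S.subst σ).eval ρ n x = S.eval ρ' n x := by
  have h' : ∀ τ s x, (σ τ s).toExp.eval ρ n x = (ρ' τ s).elemAt x := h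
  induction S with
  | elem e => exact SExp.eval_subst h' e x
  | inp s => simpa [subst] using h _ s x
  | keep s => simpa [subst] using h _ s x
  | ite c a b iha ihb =>
    simp only [subst, eval_ite, iha, ihb, SExp.eval_subst h']

theorem Agree.subst {ρ : Env d I} {n : ℤ} {σ σ' : ∀ τ, J τ → Summary d I τ}
    (h : ∀ τ s, (σ τ s).Agree (σ' τ s) ρ n) (S : Summary d J τ) :
    (S.subst σ).Agree (S.subst σ') ρ n := by
  have h' : ∀ τ s x, (σ τ s).toExp.eval ρ n x = (σ' τ s).toExp.eval ρ n x :=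
    fun τ s x => (h τ s x).1
  induction S with
  | elem e => exact fun x => ⟨SExp.eval_subst_congr h' e x, rfl⟩
  | inp s => exact h _ s
  | keep s => exact h _ s
  | ite c a b iha ihb =>
    intro x
    simp only [Summary.subst, eval_ite, kept, (iha x).1, (ihb x).1, (iha x).2, (ihb x).2,
      SExp.eval_subst_congr h' c x, and_self]

theorem kept_subst {ρ : Env d I} {n : ℤ} {x : Fin d → ℤ} {σ : ∀ τ, J τ → Summary d I τ}
    {k : Option (Σ σ, I σ)}
    (h : ∀ τ s, (σ τ s).kept ρ n x = none ∨ (σ τ s).kept ρ n x = k) (S : Summary d J τ) :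
    (S.subst σ).kept ρ n x = none ∨ (S.subst σ).kept ρ n x = k := by
  induction S with
  | elem e => exact .inl rfl
  | inp s => exact h _ s
  | keep s => exact h _ s
  | ite c a b iha ihb =>
    simp only [subst, kept]
    cases (SExp.eval ρ n x (c.subst fun τ s => (σ τ s).toExp) : Bool)
    · exact ihb
    · exact iha

/-! ### Generalization -/

/-- The validity conditions of the branches are exhaustive outside the kept positions. -/
theorem exists_branch_iff (ρ : Env d I) (n : ℤ) (x : Fin d → ℤ) (S : Summary d I τ) :
    (∃ q ∈ S.branches, q.1.eval ρ n x = true) ↔ S.kept ρ n x = none := by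
  induction S with
  | elem e => simp [branches, kept, SExp.eval]
  | inp s => simp [branches, kept, SExp.eval]
  | keep s => simp [branches, kept]
  | ite c a b iha ihb =>
    cases hc : (c.eval ρ n x : Bool) <;>
      simp [branches, kept, SExp.eval, hc, ← iha, ← ihb, or_and_right, exists_or]

theorem eval_of_branch {ρ : Env d I} {n : ℤ} {x : Fin d → ℤ} {S : Summary d I τ}
    {q : SExp d I .bool × SExp d I τ.elem} (hq : q ∈ S.branches)
    (h : q.1.eval ρ n x = true) : q.2.eval ρ n x = S.eval ρ n x := by
  induction S generalizing q with
  | elem e =>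
    simp only [branches, List.mem_singleton] at hq
    subst hq; rfl
  | inp s =>
    simp only [branches, List.mem_singleton] at hq
    subst hq; rfl
  | keep s => simp [branches] at hq
  | ite c a b iha ihb =>
    simp only [branches, List.mem_append, List.mem_map] at hq
    rcases hq with ⟨q', hq', rfl⟩ | ⟨q', hq', rfl⟩
    · simp only [SExp.eval, Bool.and_eq_true] at h
      simp [h.1, iha hq' h.2]
    · simp only [SExp.eval, Bool.and_eq_true, Bool.not_eq_true'] at h
      simp [h.1, ihb hq' h.2]

theorem foldr_ite_of_forall_false {ρ : Env d I} {n : ℤ} {x : Fin d → ℤ} {hat : Summary d I τ}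
    {l : List (SExp d I .bool × SExp d I τ.elem)}
    (h : ∀ q ∈ l, q.1.eval ρ n x ≠ true) :
    (l.foldr (fun q S' => ite q.1 (.elem q.2) S') hat).eval ρ n x = hat.eval ρ n x ∧
    (l.foldr (fun q S' => ite q.1 (.elem q.2) S') hat).kept ρ n x = hat.kept ρ n x := by
  induction l with
  | nil => simp
  | cons q l ih =>
    have h1 : (q.1.eval ρ n x : Bool) = false := by simpa using h q (by simp)
    have h2 := ih fun q' hq' => h q' (by simp [hq'])
    simpa [kept, h1] using h2

theorem foldr_ite_of_exists_true {ρ : Env d I} {n : ℤ} {x : Fin d → ℤ} {hat : Summary d I τ}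
    {l : List (SExp d I .bool × SExp d I τ.elem)} {v : Val d τ.elem}
    (hv : ∀ q ∈ l, q.1.eval ρ n x = true → q.2.eval ρ n x = v)
    (h : ∃ q ∈ l, q.1.eval ρ n x = true) :
    (l.foldr (fun q S' => ite q.1 (.elem q.2) S') hat).eval ρ n x = v ∧
    (l.foldr (fun q S' => ite q.1 (.elem q.2) S') hat).kept ρ n x = none := by
  induction l with
  | nil => simp at h
  | cons q l ih =>
    cases h1 : (q.1.eval ρ n x : Bool) with
    | true => simp [kept, h1, hv q (by simp) h1]
    | false =>
      have h2 := ih (fun q' hq' => hv q' (by simp [hq'])) (by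
        obtain ⟨q', hq', hq''⟩ := h
        rcases List.mem_cons.1 hq' with rfl | hq'
        · simp_all
        · exact ⟨q', hq', hq''⟩)
      simpa [kept, h1] using h2

/-- The condition of a generalized branch: iteration `t₁` is the last one, up to the current
iteration, that updates the position. -/
theorem exists_generalized_branch_iff (N : ℕ) (ρ : Env d I) (t : ℤ) (x : Fin d → ℤ)
    (S : Summary d I τ) (q : SExp d I .bool × SExp d I τ.elem) (t₁ : ℕ) (htN : t ≤ N)
    (ht₁ : t₁ ≤ N) :
    (SExp.eval ρ t x (.and (.and (.cmp .le (.ilit t₁) .iter) (SExp.inst (.ilit t₁) .pos q.1))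
      (.not (SExp.disj ((List.range' (t₁ + 1) (N - t₁)).map fun t₂ : ℕ =>
        .and (.cmp .le (.ilit t₂) .iter)
          (SExp.inst (.ilit t₂) .pos (SExp.disj (S.branches.map Prod.fst))))))) : Bool) = true ↔
    (t₁ : ℤ) ≤ t ∧ q.1.eval ρ t₁ x = true ∧
      ∀ t₂ : ℕ, t₁ < t₂ → (t₂ : ℤ) ≤ t → S.kept ρ t₂ x ≠ none := by
  have hdisj : ∀ t₂ : ℤ, (SExp.eval ρ t₂ x (SExp.disj (S.branches.map Prod.fst)) : Bool) = true ↔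
      S.kept ρ t₂ x = none := by
    intro t₂
    rw [SExp.eval_disj, ← exists_branch_iff]
    simp
  rw [SExp.eval_and, SExp.eval_and, SExp.eval_le, SExp.eval_not, SExp.eval_disj, SExp.eval_inst,
    and_assoc]
  refine and_congr_right fun _ => and_congr_right fun _ => ?_
  constructor
  · intro h t₂ h1 h2 h3
    refine h ⟨_, List.mem_map.2 ⟨t₂, ?_, rfl⟩, ?_⟩
    · rw [List.mem_range'_1]; omega
    · rw [SExp.eval_and, SExp.eval_le, SExp.eval_inst]
      exact ⟨h2, (hdisj t₂).2 h3⟩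
  · rintro h ⟨c, hc, hc'⟩
    obtain ⟨t₂, ht₂, rfl⟩ := List.mem_map.1 hc
    rw [List.mem_range'_1] at ht₂
    rw [SExp.eval_and, SExp.eval_le, SExp.eval_inst] at hc'
    exact h t₂ (by omega) hc'.1 ((hdisj t₂).1 hc'.2)

/-- A position that has not been updated up to iteration `t` has the initial value. -/
theorem generalize_of_forall_kept (N : ℕ) (hat S : Summary d I τ) (ρ : Env d I) (t : ℤ)
    (x : Fin d → ℤ) (htN : t ≤ N)
    (h : ∀ t₁ : ℕ, 1 ≤ t₁ → (t₁ : ℤ) ≤ t → S.kept ρ t₁ x ≠ none) :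
    (generalize N hat S).eval ρ t x = hat.eval ρ t x ∧
    (generalize N hat S).kept ρ t x = hat.kept ρ t x := by
  refine foldr_ite_of_forall_false ?_
  intro q' hq'
  obtain ⟨q, hq, hq'⟩ := List.mem_flatMap.1 hq'
  obtain ⟨t₁, ht₁, rfl⟩ := List.mem_map.1 hq'
  rw [List.mem_range'_1] at ht₁
  intro hg
  obtain ⟨h1, h2, -⟩ :=
    (exists_generalized_branch_iff N ρ t x S q t₁ htN (by omega)).1 hg
  exact h t₁ ht₁.1 h1 ((exists_branch_iff ρ t₁ x S).1 ⟨q, hq, h2⟩)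

/-- A position that has last been updated in iteration `t₁ ≤ t` has the value of this update. -/
theorem generalize_of_last_update (N : ℕ) (hat S : Summary d I τ) (ρ : Env d I) (t : ℤ)
    (x : Fin d → ℤ) (htN : t ≤ N) (t₁ : ℕ) (h1 : 1 ≤ t₁) (h1t : (t₁ : ℤ) ≤ t)
    (hk : S.kept ρ t₁ x = none)
    (h : ∀ t₂ : ℕ, t₁ < t₂ → (t₂ : ℤ) ≤ t → S.kept ρ t₂ x ≠ none) :
    (generalize N hat S).eval ρ t x = S.eval ρ t₁ x ∧
    (generalize N hat S).kept ρ t x = none := by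
  refine foldr_ite_of_exists_true ?_ ?_
  · intro q' hq'
    obtain ⟨q, hq, hq'⟩ := List.mem_flatMap.1 hq'
    obtain ⟨t', ht', rfl⟩ := List.mem_map.1 hq'
    rw [List.mem_range'_1] at ht'
    intro hg
    obtain ⟨h1', h2', h3'⟩ :=
      (exists_generalized_branch_iff N ρ t x S q t' htN (by omega)).1 hg
    have hk' := (exists_branch_iff ρ t' x S).1 ⟨q, hq, h2'⟩
    obtain rfl : t' = t₁ := by
      rcases lt_trichotomy t' t₁ with hlt | rfl | hlt
      · exact absurd hk (h3' t₁ hlt h1t)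
      · rfl
      · exact absurd hk' (h t' hlt h1')
    simpa [SExp.eval_inst, SExp.eval] using eval_of_branch hq h2'
  · obtain ⟨q, hq, hq'⟩ := (exists_branch_iff ρ t₁ x S).2 hk
    refine ⟨_, List.mem_flatMap.2 ⟨q, hq, List.mem_map.2 ⟨t₁, ?_, rfl⟩⟩, ?_⟩
    · rw [List.mem_range'_1]; omega
    · exact (exists_generalized_branch_iff N ρ t x S q t₁ htN (by omega)).2 ⟨h1t, hq', h⟩

/-- Either no iteration up to `t` updates the position, or there is a last one that does. -/
theorem forall_kept_or_exists_last_update (S : Summary d I τ) (ρ : Env d I) (x : Fin d → ℤ)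
    (t : ℕ) :
    (∀ t₁ : ℕ, 1 ≤ t₁ → (t₁ : ℤ) ≤ t → S.kept ρ t₁ x ≠ none) ∨
    ∃ t₁ : ℕ, 1 ≤ t₁ ∧ (t₁ : ℤ) ≤ t ∧ S.kept ρ t₁ x = none ∧
      ∀ t₂ : ℕ, t₁ < t₂ → (t₂ : ℤ) ≤ t → S.kept ρ t₂ x ≠ none := by
  induction t with
  | zero => left; intro t₁ h1 h2; omega
  | succ t ih =>
    by_cases hk : S.kept ρ ((t + 1 : ℕ) : ℤ) x = none
    · exact .inr ⟨t + 1, by omega, le_rfl, hk, fun t₂ h1 h2 => by omega⟩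
    · rcases ih with h | ⟨t₁, h1, h2, h3, h4⟩
      · left
        intro t₁ h1 h2
        rcases eq_or_ne t₁ (t + 1) with rfl | hne
        · exact hk
        · exact h t₁ h1 (by omega)
      · refine .inr ⟨t₁, h1, by omega, h3, fun t₂ h5 h6 => ?_⟩
        rcases eq_or_ne t₂ (t + 1) with rfl | hne
        · exact hk
        · exact h4 t₂ h5 (by omega)

theorem kept_generalize (N : ℕ) (s : I τ) (S : Summary d I τ) (ρ : Env d I) (t : ℕ)
    (x : Fin d → ℤ) (htN : t ≤ N) :
    (generalize N (.keep s) S).kept ρ t x = none ∨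
    (generalize N (.keep s) S).kept ρ t x = some ⟨τ, s⟩ := by
  rcases forall_kept_or_exists_last_update S ρ x t with h | ⟨t₁, h1, h2, h3, h4⟩
  · exact .inr (generalize_of_forall_kept N _ S ρ t x (by exact_mod_cast htN) h).2
  · exact .inl (generalize_of_last_update N _ S ρ t x (by exact_mod_cast htN) t₁ h1 h2 h3 h4).2

/-- In iteration `t`, the generalized summary depends on the iterations `1, …, t` only. -/
theorem Agree.generalize {N : ℕ} {s : I τ} {S T : Summary d I τ} {ρ : Env d I} {t : ℕ}
    (htN : t ≤ N) (h : ∀ t' : ℕ, 1 ≤ t' → t' ≤ t → S.Agree T ρ t') :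
    (generalize N (.keep s) S).Agree (generalize N (.keep s) T) ρ t := by
  intro x
  have htN' : (t : ℤ) ≤ N := by exact_mod_cast htN
  rcases forall_kept_or_exists_last_update S ρ x t with hk | ⟨t₁, h1, h2, h3, h4⟩
  · have hS := generalize_of_forall_kept N (.keep s) S ρ t x htN' hk
    have hT := generalize_of_forall_kept N (.keep s) T ρ t x htN' fun t₁ h1 h2 => by
      rw [← (h t₁ h1 (by omega) x).2]; exact hk t₁ h1 h2
    exact ⟨hS.1.trans hT.1.symm, hS.2.trans hT.2.symm⟩
  · have hS := generalize_of_last_update N (.keep s) S ρ t x htN' t₁ h1 h2 h3 h4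
    have h1' := h t₁ h1 (by omega) x
    have hT := generalize_of_last_update N (.keep s) T ρ t x htN' t₁ h1 h2 (h1'.2 ▸ h3)
      fun t₂ h5 h6 => by rw [← (h t₂ (by omega) (by omega) x).2]; exact h4 t₂ h5 h6
    exact ⟨hS.1.trans (h1'.1.trans hT.1.symm), hS.2.trans hT.2.symm⟩

end Summary

end StencilLifting

namespace StencilLifting

/-! ### Summary rules -/

namespace Op

variable {d : ℕ} {I J V V' V'' : Ty → Type} {τ : Ty}

theorem map_map (g : ∀ σ, V σ → V' σ) (g' : ∀ σ, V' σ → V'' σ) (o : Op d I J V τ) :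
    (o.map g).map g' = o.map fun σ u => g' σ (g σ u) := by
  cases o <;> simp [map]

theorem uses_map (g : ∀ σ, V σ → V' σ) (o : Op d I J V τ) (w : Σ σ, V' σ) :
    (o.map g).Uses w ↔ ∃ u : Σ σ, V σ, o.Uses u ∧ w = ⟨u.1, g u.1 u.2⟩ := by
  cases o <;> simp [map, Uses, or_and_right, exists_or] <;> aesop

theorem eval_map (ρ : Env d I) (n : ℤ) (call : Env d J → Val d .arr) (g : ∀ σ, V σ → V' σ)
    (rd : ∀ σ, V' σ → Val d σ) (o : Op d I J V τ) :
    (o.map g).eval ρ n rd call = o.eval ρ n (fun σ u => rd σ (g σ u)) call := by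
  cases o <;> simp [map, eval, List.foldr_map]

theorem isLoopPhi_map (g : ∀ σ, V σ → V' σ) (o : Op d I J V τ) :
    (o.map g).IsLoopPhi ↔ o.IsLoopPhi := by
  cases o <;> simp [map, IsLoopPhi]

theorem isLoopcall_map (g : ∀ σ, V σ → V' σ) (o : Op d I J V τ) :
    (o.map g).IsLoopcall ↔ o.IsLoopcall := by
  cases o <;> simp [map, IsLoopcall]

theorem foldr_bif_congr {β : Type} {brs : List (V .bool × V τ)} {f f' : V .bool × V τ → Bool}
    {g g' : V .bool × V τ → β} {e e' : β} (hf : ∀ p ∈ brs, f p = f' p)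
    (hg : ∀ p ∈ brs, g p = g' p) (he : e = e') :
    brs.foldr (fun p r => bif f p then g p else r) e =
      brs.foldr (fun p r => bif f' p then g' p else r) e' := by
  subst he
  induction brs with
  | nil => rfl
  | cons p brs ih =>
    simp only [List.foldr_cons, hf p (by simp), hg p (by simp),
      ih (fun q hq => hf q (by simp [hq])) (fun q hq => hg q (by simp [hq]))]

theorem eval_congr {ρ : Env d I} {n : ℤ} {call : Env d J → Val d .arr}
    {rd rd' : ∀ σ, V σ → Val d σ} (o : Op d I J V τ)
    (h : ∀ σ w, o.Uses ⟨σ, w⟩ → rd σ w = rd' σ w) :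
    o.eval ρ n rd call = o.eval ρ n rd' call := by
  cases o with
  | phi brs els =>
    exact foldr_bif_congr (fun p hp => h _ _ (.inl ⟨p, hp, .inl rfl⟩))
      (fun p hp => h _ _ (.inl ⟨p, hp, .inr rfl⟩)) (h _ _ (.inr rfl))
  | loopPhi init brs els =>
    exact foldr_bif_congr (fun p hp => h _ _ (.inr (.inl ⟨p, hp, .inl rfl⟩)))
      (fun p hp => h _ _ (.inr (.inl ⟨p, hp, .inr rfl⟩))) (h _ _ (.inr (.inr rfl)))
  | loopcall args =>
    exact congrArg call (funext fun σ => funext fun s => h _ _ ⟨σ, s, rfl⟩)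
  | get A ix =>
    have hi : (fun i => rd .idx (ix i)) = fun i => rd' .idx (ix i) :=
      funext fun i => h _ _ (.inr ⟨i, rfl⟩)
    simp only [eval, hi, h _ A (.inl rfl)]
  | set A ix e =>
    have hi : (fun i => rd .idx (ix i)) = fun i => rd' .idx (ix i) :=
      funext fun i => h _ _ (.inr (.inl ⟨i, rfl⟩))
    simp only [eval, hi, h _ A (.inl rfl), h _ e (.inr (.inr rfl))]
  | _ => simp_all [eval, Uses]

/-- The summary rule reads the operands only. -/
theorem rule_congr {post : Summary d J .arr} {rd rd' : ∀ σ, V σ → Summary d I σ}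
    (o : Op d I J V τ) (h : ∀ σ w, o.Uses ⟨σ, w⟩ → rd σ w = rd' σ w) :
    o.rule rd post = o.rule rd' post := by
  cases o with
  | phi brs els =>
    simp only [rule, h _ els (.inr rfl)]
    refine List.foldr_ext _ _ _ fun p hp r => ?_
    rw [h _ p.1 (.inl ⟨p, hp, .inl rfl⟩), h _ p.2 (.inl ⟨p, hp, .inr rfl⟩)]
  | loopPhi init brs els =>
    simp only [rule, h _ els (.inr (.inr rfl))]
    refine List.foldr_ext _ _ _ fun p hp r => ?_
    rw [h _ p.1 (.inr (.inl ⟨p, hp, .inl rfl⟩)), h _ p.2 (.inr (.inl ⟨p, hp, .inr rfl⟩))]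
  | loopcall args =>
    have : (fun σ s => rd σ (args σ s)) = fun σ s => rd' σ (args σ s) :=
      funext fun σ => funext fun s => h _ _ ⟨σ, s, rfl⟩
    simp only [rule, this]
  | get A ix =>
    have hi : (fun i => (rd .idx (ix i)).toExp) = fun i => (rd' .idx (ix i)).toExp :=
      funext fun i => by rw [h _ (ix i) (.inr ⟨i, rfl⟩)]
    simp only [rule, hi, h _ A (.inl rfl)]
  | set A ix e =>
    have hi : (fun i => (rd .idx (ix i)).toExp) = fun i => (rd' .idx (ix i)).toExp :=
      funext fun i => by rw [h _ (ix i) (.inr (.inl ⟨i, rfl⟩))]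
    simp only [rule, hi, h _ A (.inl rfl), h _ e (.inr (.inr rfl))]
  | _ => simp_all [rule, Uses]

theorem foldr_ite_agree {ρ : Env d I} {n : ℤ} {rd rd' : ∀ σ, V σ → Summary d I σ}
    {brs : List (V .bool × V τ)} {e e' : Summary d I τ}
    (hc : ∀ p ∈ brs, (rd .bool p.1).Agree (rd' .bool p.1) ρ n)
    (hv : ∀ p ∈ brs, (rd τ p.2).Agree (rd' τ p.2) ρ n) (he : e.Agree e' ρ n) :
    (brs.foldr (fun p r => Summary.ite (rd .bool p.1).toExp (rd τ p.2) r) e).Agree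
      (brs.foldr (fun p r => Summary.ite (rd' .bool p.1).toExp (rd' τ p.2) r) e') ρ n := by
  induction brs with
  | nil => exact he
  | cons p brs ih =>
    intro x
    have h1 := ih (fun q hq => hc q (by simp [hq])) (fun q hq => hv q (by simp [hq])) x
    have h2 := hv p (by simp) x
    have h3 := (hc p (by simp) x).1
    simp only [List.foldr_cons, Summary.eval_ite, Summary.kept, Summary.toExp_eval, h1, h2, h3,
      and_self]

/-- The summary rule preserves agreement. -/
theorem rule_agree {ρ : Env d I} {n : ℤ} {post : Summary d J .arr}
    {rd rd' : ∀ σ, V σ → Summary d I σ} (o : Op d I J V τ)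
    (h : ∀ σ w, o.Uses ⟨σ, w⟩ → (rd σ w).Agree (rd' σ w) ρ n) :
    (o.rule rd post).Agree (o.rule rd' post) ρ n := by
  have h' : ∀ σ w, o.Uses ⟨σ, w⟩ → ∀ x,
      (rd σ w).toExp.eval ρ n x = (rd' σ w).toExp.eval ρ n x := fun σ w hw x => (h σ w hw x).1
  cases o with
  | phi brs els =>
    exact foldr_ite_agree (fun p hp => h _ _ (.inl ⟨p, hp, .inl rfl⟩))
      (fun p hp => h _ _ (.inl ⟨p, hp, .inr rfl⟩)) (h _ _ (.inr rfl))
  | loopPhi init brs els =>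
    exact foldr_ite_agree (fun p hp => h _ _ (.inr (.inl ⟨p, hp, .inl rfl⟩)))
      (fun p hp => h _ _ (.inr (.inl ⟨p, hp, .inr rfl⟩))) (h _ _ (.inr (.inr rfl)))
  | loopcall args => exact Summary.Agree.subst (fun σ s => h _ _ ⟨σ, s, rfl⟩) post
  | get A ix =>
    intro x
    have hi : (fun i => (rd .idx (ix i)).toExp.eval ρ n x) =
        fun i => (rd' .idx (ix i)).toExp.eval ρ n x :=
      funext fun i => h' _ (ix i) (.inr ⟨i, rfl⟩) x
    refine ⟨?_, rfl⟩
    simp only [rule, Summary.eval_elem, SExp.eval_inst, SExp.eval, hi, h' _ A (.inl rfl)]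
  | set A ix e =>
    intro x
    have hi : (fun i => (rd .idx (ix i)).toExp.eval ρ n x) =
        fun i => (rd' .idx (ix i)).toExp.eval ρ n x :=
      funext fun i => h' _ (ix i) (.inr (.inl ⟨i, rfl⟩)) x
    simp only [rule, Summary.eval_ite, Summary.kept, SExp.eval_posEq, hi, Summary.eval_elem,
      h' _ e (.inr (.inr rfl)), (h _ A (.inl rfl) x).1, (h _ A (.inl rfl) x).2, and_self]
  | input s => exact Summary.Agree.refl _ _ _
  | _ =>
    intro x
    refine ⟨?_, rfl⟩
    simp_all [rule, Uses, SExp.eval]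

theorem kept_foldr_ite {ρ : Env d I} {n : ℤ} {x : Fin d → ℤ} {rd : ∀ σ, V σ → Summary d I σ}
    {k : Option (Σ σ, I σ)} {brs : List (V .bool × V τ)} {e : Summary d I τ}
    (hv : ∀ p ∈ brs, (rd τ p.2).kept ρ n x = none ∨ (rd τ p.2).kept ρ n x = k)
    (he : e.kept ρ n x = none ∨ e.kept ρ n x = k) :
    (brs.foldr (fun p r => Summary.ite (rd .bool p.1).toExp (rd τ p.2) r) e).kept ρ n x = none ∨
    (brs.foldr (fun p r => Summary.ite (rd .bool p.1).toExp (rd τ p.2) r) e).kept ρ n x = k := by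
  induction brs with
  | nil => exact he
  | cons p brs ih =>
    simp only [List.foldr_cons, Summary.kept]
    cases (SExp.eval ρ n x (rd .bool p.1).toExp : Bool)
    · exact ih fun q hq => hv q (by simp [hq])
    · exact hv p (by simp)

/-- A summary rule keeps an initial value only where one of its operands does. -/
theorem kept_rule {ρ : Env d I} {n : ℤ} {x : Fin d → ℤ} {post : Summary d J .arr}
    {rd : ∀ σ, V σ → Summary d I σ} {k : Option (Σ σ, I σ)} (o : Op d I J V τ)
    (h : ∀ σ w, o.Uses ⟨σ, w⟩ → (rd σ w).kept ρ n x = none ∨ (rd σ w).kept ρ n x = k) :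
    (o.rule rd post).kept ρ n x = none ∨ (o.rule rd post).kept ρ n x = k := by
  cases o with
  | phi brs els =>
    exact kept_foldr_ite (fun p hp => h _ _ (.inl ⟨p, hp, .inr rfl⟩)) (h _ _ (.inr rfl))
  | loopPhi init brs els =>
    exact kept_foldr_ite (fun p hp => h _ _ (.inr (.inl ⟨p, hp, .inr rfl⟩)))
      (h _ _ (.inr (.inr rfl)))
  | loopcall args => exact Summary.kept_subst (fun σ s => h _ _ ⟨σ, s, rfl⟩) post
  | set A ix e =>
    simp only [rule, Summary.kept]
    cases (SExp.eval ρ n x (.posEq fun i => (rd .idx (ix i)).toExp) : Bool)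
    · exact h _ A (.inl rfl)
    · exact .inl rfl
  | _ => exact .inl rfl

theorem foldr_ite_denotes {ρ : Env d I} {n : ℤ} {rd : ∀ σ, V σ → Summary d I σ}
    {rv : ∀ σ, V σ → Val d σ} {brs : List (V .bool × V τ)} {e : Summary d I τ} {v : Val d τ}
    (hc : ∀ p ∈ brs, (rd .bool p.1).Denotes ρ n (rv .bool p.1))
    (hv : ∀ p ∈ brs, (rd τ p.2).Denotes ρ n (rv τ p.2)) (he : e.Denotes ρ n v) :
    (brs.foldr (fun p r => Summary.ite (rd .bool p.1).toExp (rd τ p.2) r) e).Denotes ρ n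
      (brs.foldr (fun p r => bif rv .bool p.1 then rv τ p.2 else r) v) := by
  induction brs with
  | nil => exact he
  | cons p brs ih =>
    intro x
    have h1 := ih (fun q hq => hc q (by simp [hq])) (fun q hq => hv q (by simp [hq])) x
    have h2 := hv p (by simp) x
    have h3 : (rd .bool p.1).eval ρ n x = rv .bool p.1 := hc p (by simp) x
    simp only [List.foldr_cons, Summary.eval_ite, Summary.toExp_eval, h1, h2, h3]
    cases (rv .bool p.1 : Bool) <;> rfl

/-- Soundness of the summary rules: summaries of the operands and a postcondition of the loop one
level below yield a summary of the result. -/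
theorem rule_denotes {ρ : Env d I} {n : ℤ} {post : Summary d J .arr}
    {call : Env d J → Val d .arr} {rd : ∀ σ, V σ → Summary d I σ} {rv : ∀ σ, V σ → Val d σ}
    (o : Op d I J V τ) (hpost : o.IsLoopcall → ∀ ρ', post.Holds ρ' (call ρ'))
    (h : ∀ σ w, o.Uses ⟨σ, w⟩ → (rd σ w).Denotes ρ n (rv σ w)) :
    (o.rule rd post).Denotes ρ n (o.eval ρ n rv call) := by
  have h' : ∀ σ w, o.Uses ⟨σ, w⟩ → ∀ x,
      (rd σ w).toExp.eval ρ n x = (rv σ w).elemAt x := fun σ w hw x => h σ w hw x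
  cases o with
  | phi brs els =>
    exact foldr_ite_denotes (fun p hp => h _ _ (.inl ⟨p, hp, .inl rfl⟩))
      (fun p hp => h _ _ (.inl ⟨p, hp, .inr rfl⟩)) (h _ _ (.inr rfl))
  | loopPhi init brs els =>
    exact foldr_ite_denotes (fun p hp => h _ _ (.inr (.inl ⟨p, hp, .inl rfl⟩)))
      (fun p hp => h _ _ (.inr (.inl ⟨p, hp, .inr rfl⟩))) (h _ _ (.inr (.inr rfl)))
  | loopcall args =>
    intro x
    simp only [rule, eval]
    rw [Summary.eval_subst (ρ' := fun σ s => rv σ (args σ s)) (fun σ s => h _ _ ⟨σ, s, rfl⟩)]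
    exact (hpost trivial _ n x).symm
  | get A ix =>
    intro x
    have hi : (fun i => (rd .idx (ix i)).toExp.eval ρ n x) = fun i => rv .idx (ix i) :=
      funext fun i => h' _ (ix i) (.inr ⟨i, rfl⟩) x
    simp only [rule, Summary.eval_elem, SExp.eval_inst, SExp.eval, hi, h' _ A (.inl rfl)]
    rfl
  | set A ix e =>
    intro x
    have hi : (fun i => (rd .idx (ix i)).toExp.eval ρ n x) = fun i => rv .idx (ix i) :=
      funext fun i => h' _ (ix i) (.inr (.inl ⟨i, rfl⟩)) x
    have hA : (rd .arr A).eval ρ n x = rv .arr A x := h' _ A (.inl rfl) x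
    have he : (rd .num e).toExp.eval ρ n x = rv .num e := h' _ e (.inr (.inr rfl)) x
    simp only [rule, Summary.eval_ite, SExp.eval_posEq, hi, Summary.eval_elem, hA, he, eval,
      Val.elemAt, Function.update_apply]
    by_cases hx : x = fun i => rv .idx (ix i) <;> simp [hx]
  | input s => exact fun x => Summary.eval_inp ρ n x s
  | _ =>
    intro x
    simp_all [rule, Uses, SExp.eval, eval, Val.elemAt, IdxOp.eval]

end Op

end StencilLifting

namespace StencilLifting

/-! ### Sequential updates -/

section SequentialUpdate

variable {α : Type*} [DecidableEq α] {β : α → Type*} (F : (∀ a, β a) → ∀ a, β a)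

theorem foldl_update_of_notMem {l : List α} {a : α} (h : a ∉ l) (f : ∀ a, β a) :
    l.foldl (fun cur b => Function.update cur b (F cur b)) f a = f a := by
  induction l generalizing f with
  | nil => rfl
  | cons b l ih =>
    rw [List.mem_cons, not_or] at h
    rw [List.foldl_cons, ih h.2, Function.update_of_ne h.1]

/-- In a sequence of assignments to distinct variables, the statement of `a` reads the final values
of the variables that are assigned before, and the original values of all others. -/
theorem exists_foldl_update_eq {l l₁ l₂ : List α} {a : α} (hl : l.Nodup) (h : l = l₁ ++ a :: l₂)
    (f : ∀ a, β a) :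
    ∃ cur : ∀ a, β a,
      l.foldl (fun cur b => Function.update cur b (F cur b)) f a = F cur a ∧
      (∀ b ∈ l₁, cur b = l.foldl (fun cur b => Function.update cur b (F cur b)) f b) ∧
      ∀ b ∉ l₁, cur b = f b := by
  subst h
  have hd := (List.nodup_append.1 hl).2.2
  have ha := (List.nodup_cons.1 (List.nodup_append.1 hl).2.1).1
  refine ⟨l₁.foldl (fun cur b => Function.update cur b (F cur b)) f, ?_, ?_, ?_⟩
  · rw [List.foldl_append, List.foldl_cons, foldl_update_of_notMem F ha, Function.update_self]
  · intro b hb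
    rw [List.foldl_append, foldl_update_of_notMem F fun hb' => hd b hb b hb' rfl]
  · intro b hb
    exact foldl_update_of_notMem F hb f

end SequentialUpdate

namespace DepGraph

variable {d : ℕ} {I J : Ty → Type} {G : DepGraph d I J}

/-! ### Semantics of a dependency graph -/

/-- The properties that a dependency graph inherits from the code of a loop. The rank is the
position in the body; it increases along the edges within a loop slice. -/
structure Regular (G : DepGraph d I J) : Prop where
  finite : Finite G.Vert
  init_input : ∀ {τ : Ty} (v init : G.V τ) brs els,
    G.op v = .loopPhi init brs els → (G.op init).IsInput
  exists_rank : ∃ rank : G.Vert → ℕ, ∀ w v, G.Edge w v → ¬ G.IsLoopPhi w → rank w < rank v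

open Classical in
/-- The value of the operand `w` in iteration `n`, where `val` gives the values at the end of each
iteration: a loop-carried variable is read from the previous iteration. -/
noncomputable def readVal (G : DepGraph d I J) (val : ℕ → ∀ v : G.Vert, Val d v.1) (n : ℕ)
    (σ : Ty) (w : G.V σ) : Val d σ :=
  if G.IsLoopPhi ⟨σ, w⟩ then val (n - 1) ⟨σ, w⟩ else val n ⟨σ, w⟩

/-- `val n v` is the value of `v` at the end of iteration `n` of an execution of the loop; for a
loop-carried variable, `val 0 v` is the value at loop entry. -/
structure IsTrace (G : DepGraph d I J) (call : Env d J → Val d .arr) (ρ : Env d I)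
    (val : ℕ → ∀ v : G.Vert, Val d v.1) : Prop where
  step : ∀ n, 1 ≤ n → n ≤ G.trip → ∀ v : G.Vert,
    val n v = (G.op v.2).eval ρ n (G.readVal val n) call
  entry : ∀ {τ : Ty} (v init : G.V τ) brs els s,
    G.op v = .loopPhi init brs els → G.op init = .input s → val 0 ⟨τ, v⟩ = ρ τ s

theorem not_isLoopPhi_of_input {v : G.Vert} (h : (G.op v.2).IsInput) : ¬ G.IsLoopPhi v := by
  obtain ⟨s, hs⟩ := h
  rintro ⟨i, b, e, h⟩
  rw [hs] at h
  cases h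

theorem not_edge_of_input {w v : G.Vert} (h : (G.op v.2).IsInput) : ¬ G.Edge w v := by
  obtain ⟨s, hs⟩ := h
  rw [Edge, hs]
  exact id

theorem edge_init {τ : Ty} {v init : G.V τ} {brs els} (h : G.op v = .loopPhi init brs els) :
    G.Edge ⟨τ, init⟩ ⟨τ, v⟩ := by
  simp [Edge, h, Op.Uses]

/-! ### Reading the tensor -/

theorem read_of_not_isLoopPhi {start : Option G.Vert} {S : G.Tensor} {σ : Ty} {w : G.V σ}
    (h : ¬ G.IsLoopPhi ⟨σ, w⟩) : G.read start S σ w = S ⟨σ, w⟩ := by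
  unfold read
  split
  · next h' => exact absurd ⟨_, _, _, h'⟩ h
  · rfl

theorem read_start {S : G.Tensor} {σ : Ty} {w : G.V σ} :
    G.read (some ⟨σ, w⟩) S σ w = S ⟨σ, w⟩ := by
  unfold read
  split
  · rw [if_pos rfl]
  · rfl

theorem read_of_isLoopPhi {start : Option G.Vert} {S : G.Tensor} {σ : Ty} {w init : G.V σ} {brs els}
    (h : G.op w = .loopPhi init brs els) (hw : start ≠ some ⟨σ, w⟩) :
    G.read start S σ w =
      .ite (.cmp .eq .iter (.ilit 1)) (S ⟨σ, init⟩) (S ⟨σ, w⟩).shift := by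
  unfold read
  split
  · next i' b' e' h' =>
    rw [h'] at h
    cases h
    rw [if_neg hw]
  · next h' => exact absurd h (h' _ _ _)

/-- Reading an operand other than the start vertex depends only on its summary and, for a
loop-carried variable, on the summary of its initial value. -/
theorem read_congr {start start' : Option G.Vert} {S S' : G.Tensor} {σ : Ty} {w : G.V σ}
    (hw : start ≠ some ⟨σ, w⟩) (hw' : start' ≠ some ⟨σ, w⟩) (h : S ⟨σ, w⟩ = S' ⟨σ, w⟩)
    (hi : ∀ init brs els, G.op w = .loopPhi init brs els → S ⟨σ, init⟩ = S' ⟨σ, init⟩) :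
    G.read start S σ w = G.read start' S' σ w := by
  by_cases hp : G.IsLoopPhi ⟨σ, w⟩
  · obtain ⟨init, brs, els, hp⟩ := hp
    rw [read_of_isLoopPhi hp hw, read_of_isLoopPhi hp hw', h, hi _ _ _ hp]
  · rw [read_of_not_isLoopPhi hp, read_of_not_isLoopPhi hp, h]

/-- The tensor holds a final summary of the vertex `v`: it denotes the value of `v` in every
iteration, and it contains no final branch of a running extraction. -/
structure Summarized (val : Env d I → ℕ → ∀ v : G.Vert, Val d v.1) (S : G.Tensor)
    (v : G.Vert) : Prop where
  denotes : ∀ ρ (n : ℕ), 1 ≤ n → n ≤ G.trip → (S v).Denotes ρ n (val ρ n v)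
  kept : ∀ ρ n x, (S v).kept ρ n x = none
  input : ∀ s, G.op v.2 = .input s → S v = .inp s

theorem Summarized.congr {val : Env d I → ℕ → ∀ v : G.Vert, Val d v.1} {S S' : G.Tensor}
    {v : G.Vert} (h : Summarized val S v) (hS : S' v = S v) : Summarized val S' v :=
  ⟨hS ▸ h.denotes, hS ▸ h.kept, hS ▸ h.input⟩

/-- A loop-carried variable outside the current component is read correctly through its time-shifted
summary and its initial value. -/
theorem read_denotes (hG : G.Regular) {call : Env d J → Val d .arr}
    {val : Env d I → ℕ → ∀ v : G.Vert, Val d v.1} {ρ : Env d I}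
    (hval : G.IsTrace call ρ (val ρ)) {S : G.Tensor} {σ : Ty} {w : G.V σ}
    (hw : Summarized val S ⟨σ, w⟩) (hw' : ∀ u, G.Edge u ⟨σ, w⟩ → Summarized val S u)
    {n : ℕ} (h1 : 1 ≤ n) (hn : n ≤ G.trip) :
    (G.read none S σ w).Denotes ρ n (G.readVal (val ρ) n σ w) := by
  by_cases hp : G.IsLoopPhi ⟨σ, w⟩
  · rw [readVal, if_pos hp]
    obtain ⟨init, brs, els, hp⟩ := hp
    obtain ⟨s, hs⟩ := hG.init_input w init brs els hp
    rw [read_of_isLoopPhi hp (by simp)]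
    intro x
    rw [Summary.eval_ite, Summary.eval_shift, (hw' _ (edge_init hp)).input s hs,
      Summary.eval_inp]
    rcases eq_or_lt_of_le h1 with rfl | h1
    · have : (SExp.eval ρ ((1 : ℕ) : ℤ) x (.cmp .eq .iter (.ilit 1)) : Bool) = true := by
        rw [SExp.eval_eq]; rfl
      rw [this, cond_true, ← hval.entry w init brs els s hp hs]
    · have : (SExp.eval ρ (n : ℤ) x (.cmp .eq .iter (.ilit 1)) : Bool) = false := by
        rw [← Bool.not_eq_true, SExp.eval_eq]
        exact fun h : (n : ℤ) = 1 => by omega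
      rw [this, cond_false]
      have := hw.denotes ρ (n - 1) (by omega) ((Nat.sub_le _ _).trans hn) x
      rwa [Nat.cast_pred (by omega)] at this
  · rw [readVal, if_neg hp, read_of_not_isLoopPhi hp]
    exact hw.denotes ρ n h1 hn

theorem read_kept {val : Env d I → ℕ → ∀ v : G.Vert, Val d v.1} {S : G.Tensor} {σ : Ty}
    {w : G.V σ} (hw : Summarized val S ⟨σ, w⟩)
    (hw' : ∀ u, G.Edge u ⟨σ, w⟩ → Summarized val S u) (ρ : Env d I) (n : ℤ) (x : Fin d → ℤ) :
    (G.read none S σ w).kept ρ n x = none := by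
  by_cases hp : G.IsLoopPhi ⟨σ, w⟩
  · obtain ⟨init, brs, els, hp⟩ := hp
    rw [read_of_isLoopPhi hp (by simp), Summary.kept, Summary.kept_shift, hw.kept,
      (hw' _ (edge_init hp)).kept, Bool.cond_self]
  · rw [read_of_not_isLoopPhi hp, hw.kept]

/-! ### Forward sweeps -/

/-- The list `c` is a set of vertices with the single loop-carried variable `start`, in an
admissible sweep order. -/
structure IsSweep (start : G.Vert) (c : List G.Vert) : Prop where
  nodup : c.Nodup
  last : ∃ l, c = l ++ [start]
  isLoopPhi : G.IsLoopPhi start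
  unique : ∀ w ∈ c, G.IsLoopPhi w → w = start
  not_input : ∀ w ∈ c, ¬ (G.op w.2).IsInput
  order : c.Pairwise fun a b => b ≠ start → ¬ G.Edge b a

theorem IsSweep.start_mem {start : G.Vert} {c : List G.Vert} (hc : IsSweep start c) :
    start ∈ c := by
  obtain ⟨l, rfl⟩ := hc.last
  simp

/-- Induction along a sweep: the start vertex has been set before the sweep, every other operand in
the component is visited before it is read. -/
theorem IsSweep.induction (hG : G.Regular) {start : G.Vert} {c : List G.Vert}
    (hc : IsSweep start c) {p : G.Vert → Prop}
    (h : ∀ v ∈ c, (∀ w ∈ c, w ≠ start → G.Edge w v → p w) → p v) : ∀ v ∈ c, p v := by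
  obtain ⟨rank, hrank⟩ := hG.exists_rank
  have key : ∀ n, ∀ v ∈ c, rank v = n → p v := by
    intro n
    induction n using Nat.strong_induction_on with
    | _ n ih =>
      rintro v hv rfl
      refine h v hv fun w hw hws hwv => ih _ (hrank w v hwv fun hp => hws ?_) w hw rfl
      exact hc.unique w hw hp
  exact fun v hv => key _ v hv rfl

section Sweep

variable {start : G.Vert} {c : List G.Vert} {post : G.Vert → Summary d J .arr}

theorem forwardSweep_of_notMem {v : G.Vert} (hv : v ∉ c) (S : G.Tensor) :
    G.forwardSweep start post c S v = S v := by
  classical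
  exact foldl_update_of_notMem (fun (S : G.Tensor) v => (G.op v.2).rule (G.read (some start) S)
    (post v)) hv S

open Classical in
/-- The result of a sweep, described as the solution of a system of equations: every vertex has the
summary given by its rule, where the start vertex is read through its summary `g` from before the
sweep and all other vertices are read from the result. -/
theorem forwardSweep_eq (hG : G.Regular) (hc : IsSweep start c) (S : G.Tensor)
    (g : Summary d I start.1) {v : G.Vert} (hv : v ∈ c) :
    G.forwardSweep start post c (Function.update S start g) v =
      (G.op v.2).rule (G.read (some start) (Function.update
        (G.forwardSweep start post c (Function.update S start g)) start g)) (post v) := by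
  set T : G.Tensor := Function.update S start g with hT
  set R := G.forwardSweep start post c T with hR
  have hTs : T start = g := Function.update_self _ _ _
  obtain ⟨l₁, l₂, hl⟩ := List.append_of_mem hv
  obtain ⟨cur, h1, h2, h3⟩ := exists_foldl_update_eq
    (fun (S : G.Tensor) v => (G.op v.2).rule (G.read (some start) S) (post v)) hc.nodup hl T
  replace h1 : R v = (G.op v.2).rule (G.read (some start) cur) (post v) := h1
  replace h2 : ∀ b ∈ l₁, cur b = R b := h2
  have hRc : ∀ v ∉ c, R v = T v := fun v hv => forwardSweep_of_notMem hv T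
  have hsl : start ∉ l₁ := by
    obtain ⟨l, hl'⟩ := hc.last
    have hnd := hc.nodup
    rw [hl] at hnd hl'
    have h4 : start ∈ v :: l₂ := by
      have : (l₁ ++ v :: l₂).getLast? = some start := by simp [hl']
      rw [List.getLast?_append_of_ne_nil _ (by simp)] at this
      exact List.mem_of_getLast? this
    exact fun h5 => (List.nodup_append.1 hnd).2.2 _ h5 _ h4 rfl
  have hout : ∀ w ∉ c, cur w = Function.update R start g w := by
    intro w hw
    have hws : w ≠ start := fun h => hw (h ▸ hc.start_mem)
    rw [Function.update_of_ne hws, hRc w hw, h3 w]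
    exact fun h => hw (by rw [hl]; simp [h])
  rw [h1]
  refine Op.rule_congr _ fun σ w hw => ?_
  by_cases hws : (⟨σ, w⟩ : G.Vert) = start
  · subst hws
    rw [read_start, read_start, h3 _ hsl, hTs, Function.update_self]
  by_cases hwc : (⟨σ, w⟩ : G.Vert) ∈ c
  · have hp : ¬ G.IsLoopPhi ⟨σ, w⟩ := fun hp => hws (hc.unique _ hwc hp)
    rw [read_of_not_isLoopPhi hp, read_of_not_isLoopPhi hp, Function.update_of_ne hws]
    refine h2 _ ?_
    rw [hl, List.mem_append, List.mem_cons] at hwc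
    rcases hwc with hwc | rfl | hwc
    · exact hwc
    · obtain ⟨rank, hrank⟩ := hG.exists_rank
      exact absurd (hrank _ _ hw hp) (lt_irrefl _)
    · have := hc.order
      rw [hl, List.pairwise_append] at this
      exact absurd hw ((List.pairwise_cons.1 this.2.1).1 _ hwc hws)
  · refine read_congr (fun h => hws (Option.some.inj h).symm)
      (fun h => hws (Option.some.inj h).symm) (hout _ hwc) fun init brs els hop => hout _ ?_
    exact fun h => hc.not_input _ h (hG.init_input w init brs els hop)

theorem read_update_of_mem (hc : IsSweep start c) {R : G.Tensor} {g : Summary d I start.1}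
    {σ : Ty} {w : G.V σ} (hw : ⟨σ, w⟩ ∈ c) (hws : (⟨σ, w⟩ : G.Vert) ≠ start) [DecidableEq G.Vert] :
    G.read (some start) (Function.update R start g) σ w = R ⟨σ, w⟩ := by
  rw [read_of_not_isLoopPhi fun hp => hws (hc.unique _ hw hp), Function.update_of_ne hws]

theorem read_update_of_notMem (hG : G.Regular) (hc : IsSweep start c) {R S : G.Tensor}
    (hR : ∀ v ∉ c, R v = S v) {g : Summary d I start.1} {σ : Ty} {w : G.V σ}
    (hw : ⟨σ, w⟩ ∉ c) [DecidableEq G.Vert] :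
    G.read (some start) (Function.update R start g) σ w = G.read none S σ w := by
  have hws : ∀ v ∉ c, v ≠ start := fun v hv h => hv (h ▸ hc.start_mem)
  refine read_congr (fun h => hws _ hw (Option.some.inj h).symm) (by simp) ?_ ?_
  · rw [Function.update_of_ne (hws _ hw), hR _ hw]
  · intro init brs els hop
    have hi : (⟨σ, init⟩ : G.Vert) ∉ c :=
      fun h => hc.not_input _ h (hG.init_input w init brs els hop)
    rw [Function.update_of_ne (hws _ hi), hR _ hi]

theorem forwardSweep_update_of_notMem (hc : IsSweep start c) (S : G.Tensor)
    (g : Summary d I start.1) [DecidableEq G.Vert] (v : G.Vert) (hv : v ∉ c) :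
    G.forwardSweep start post c (Function.update S start g) v = S v := by
  have hvs : v ≠ start := fun h => hv (h ▸ hc.start_mem)
  rw [forwardSweep_of_notMem hv, Function.update_of_ne hvs]

open Classical in
/-- What a sweep computes for an iteration depends only on the summary of the start vertex in the
same iteration. -/
theorem forwardSweep_agree (hG : G.Regular) (hc : IsSweep start c) {S S' : G.Tensor}
    (hS : ∀ v ∉ c, S v = S' v) {g g' : Summary d I start.1} {ρ : Env d I} {n : ℤ}
    (hg : g.Agree g' ρ n) : ∀ v ∈ c,
    (G.forwardSweep start post c (Function.update S start g) v).Agree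
      (G.forwardSweep start post c (Function.update S' start g') v) ρ n := by
  have hR := forwardSweep_update_of_notMem (post := post) hc S g
  have hR' := forwardSweep_update_of_notMem (post := post) hc S' g'
  refine hc.induction hG fun v hv ih => ?_
  rw [forwardSweep_eq hG hc S g hv, forwardSweep_eq hG hc S' g' hv]
  refine Op.rule_agree _ fun σ w hw => ?_
  by_cases hws : (⟨σ, w⟩ : G.Vert) = start
  · subst hws
    simpa only [read_start, Function.update_self] using hg
  by_cases hwc : (⟨σ, w⟩ : G.Vert) ∈ c
  · rw [read_update_of_mem hc hwc hws, read_update_of_mem hc hwc hws]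
    exact ih _ hwc hws hw
  · rw [read_update_of_notMem hG hc (fun v hv => (hR v hv).trans (hS v hv)) hwc,
      read_update_of_notMem hG hc hR' hwc]
    exact Summary.Agree.refl _ _ _

open Classical in
theorem forwardSweep_kept (hG : G.Regular) (hc : IsSweep start c) {S : G.Tensor}
    {g : Summary d I start.1} {ρ : Env d I} {n : ℤ} {x : Fin d → ℤ} {k : Option (Σ σ, I σ)}
    (hout : ∀ v ∈ c, ∀ w ∉ c, G.Edge w v → (G.read none S w.1 w.2).kept ρ n x = none)
    (hg : g.kept ρ n x = none ∨ g.kept ρ n x = k) : ∀ v ∈ c,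
    (G.forwardSweep start post c (Function.update S start g) v).kept ρ n x = none ∨
    (G.forwardSweep start post c (Function.update S start g) v).kept ρ n x = k := by
  have hR := forwardSweep_update_of_notMem (post := post) hc S g
  refine hc.induction hG fun v hv ih => ?_
  rw [forwardSweep_eq hG hc S g hv]
  refine Op.kept_rule _ fun σ w hw => ?_
  by_cases hws : (⟨σ, w⟩ : G.Vert) = start
  · subst hws
    simpa only [read_start, Function.update_self] using hg
  by_cases hwc : (⟨σ, w⟩ : G.Vert) ∈ c
  · rw [read_update_of_mem hc hwc hws]
    exact ih _ hwc hws hw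
  · rw [read_update_of_notMem hG hc hR hwc]
    exact .inl (hout v hv _ hwc hw)

open Classical in
/-- A sweep that starts from the value of the start vertex at the end of the previous iteration
computes the values of all vertices of the component in the current iteration. -/
theorem forwardSweep_denotes (hG : G.Regular) (hc : IsSweep start c)
    {call : Env d J → Val d .arr} {val : ℕ → ∀ v : G.Vert, Val d v.1} {ρ : Env d I}
    (hval : G.IsTrace call ρ val)
    (hpost : ∀ v ∈ c, G.IsLoopcall v → ∀ ρ', (post v).Holds ρ' (call ρ'))
    {S : G.Tensor} {g : Summary d I start.1} {n : ℕ} (h1 : 1 ≤ n) (hn : n ≤ G.trip)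
    (hout : ∀ v ∈ c, ∀ w ∉ c, G.Edge w v →
      (G.read none S w.1 w.2).Denotes ρ n (G.readVal val n w.1 w.2))
    (hg : g.Denotes ρ n (val (n - 1) start)) : ∀ v ∈ c,
    (G.forwardSweep start post c (Function.update S start g) v).Denotes ρ n (val n v) := by
  have hR := forwardSweep_update_of_notMem (post := post) hc S g
  refine hc.induction hG fun v hv ih => ?_
  rw [forwardSweep_eq hG hc S g hv, hval.step n h1 hn]
  refine Op.rule_denotes _ (hpost v hv) fun σ w hw => ?_
  by_cases hws : (⟨σ, w⟩ : G.Vert) = start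
  · subst hws
    rw [readVal, if_pos hc.isLoopPhi]
    simpa only [read_start, Function.update_self] using hg
  by_cases hwc : (⟨σ, w⟩ : G.Vert) ∈ c
  · rw [read_update_of_mem hc hwc hws, readVal, if_neg fun hp => hws (hc.unique _ hwc hp)]
    exact ih _ hwc hws hw
  · rw [read_update_of_notMem hG hc hR hwc]
    exact hout v hv _ hwc hw

end Sweep

end DepGraph

end StencilLifting

namespace StencilLifting

namespace DepGraph

variable {d : ℕ} {I J : Ty → Type} {G : DepGraph d I J}

/-! ### The repeat-until loop -/

open Classical in
/-- The tensor after one round of the repeat-until loop. -/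
noncomputable def round (start : G.Vert) (hat : Summary d I start.1)
    (post : G.Vert → Summary d J .arr) (c : List G.Vert) (S : G.Tensor) : G.Tensor :=
  G.forwardSweep start post c
    (Function.update S start (Summary.generalize G.trip hat (S start)).shift)

section Round

variable {start : G.Vert} {c : List G.Vert} {post : G.Vert → Summary d J .arr}

open Classical in
theorem round_of_notMem (hc : IsSweep start c) (hat : Summary d I start.1) (S : G.Tensor)
    {v : G.Vert} (hv : v ∉ c) : round start hat post c S v = S v :=
  forwardSweep_update_of_notMem hc S _ v hv

/-- The first `r` iterations have settled: the next round does not change the summary of the start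
vertex there, and a position that keeps its initial value up to the end of an iteration also
does so up to the end of the preceding one. -/
structure Settled (post : G.Vert → Summary d J .arr) (c : List G.Vert) (start : G.Vert)
    (s : I start.1) (r : ℕ) (S : G.Tensor) : Prop where
  agree : ∀ ρ (n : ℕ), 1 ≤ n → n ≤ r → n ≤ G.trip →
    (S start).Agree (round start (.keep s) post c S start) ρ n
  mono : ∀ ρ (n : ℕ) x, 1 ≤ n → n + 1 ≤ r → n + 1 ≤ G.trip →
    (S start).kept ρ ((n + 1 : ℕ) : ℤ) x ≠ none → (S start).kept ρ n x ≠ none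
  keep : ∀ ρ (n : ℕ) x, 1 ≤ n → n ≤ r → n ≤ G.trip →
    (S start).kept ρ n x = none ∨ (S start).kept ρ n x = some ⟨start.1, s⟩

theorem Settled.zero (s : I start.1) (S : G.Tensor) : Settled post c start s 0 S :=
  ⟨fun _ _ _ _ => by omega, fun _ _ _ _ _ => by omega, fun _ _ _ _ _ => by omega⟩

/-- Every round settles one more iteration, since a sweep computes iteration `n` from the
generalized summary in iteration `n - 1`, which depends on the iterations `1, …, n - 1` only. -/
theorem Settled.succ (hG : G.Regular) (hc : IsSweep start c) {s : I start.1} {r : ℕ}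
    {S : G.Tensor}
    (hout : ∀ v ∈ c, ∀ w ∉ c, G.Edge w v → ∀ ρ n x, (G.read none S w.1 w.2).kept ρ n x = none)
    (h : Settled post c start s r S) :
    Settled post c start s (r + 1) (round start (.keep s) post c S) := by
  have hkept : ∀ ρ (n : ℕ) x k, 1 ≤ n → n ≤ G.trip →
      ((Summary.generalize G.trip (.keep s) (S start)).kept ρ ((n - 1 : ℕ) : ℤ) x = none ∨
        (Summary.generalize G.trip (.keep s) (S start)).kept ρ ((n - 1 : ℕ) : ℤ) x = k) →
      (round start (.keep s) post c S start).kept ρ n x = none ∨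
        (round start (.keep s) post c S start).kept ρ n x = k := by
    intro ρ n x k h1 hn hk
    refine forwardSweep_kept hG hc (fun v hv w hw hwv => hout v hv w hw hwv ρ n x) ?_ start
      hc.start_mem
    rwa [Summary.kept_shift, ← Nat.cast_pred (by omega)]
  refine ⟨fun ρ n h1 hr hn => ?_, fun ρ n x h1 hr hn hk => ?_, fun ρ n x h1 hr hn => ?_⟩
  · refine forwardSweep_agree hG hc (fun v hv => (round_of_notMem hc _ S hv).symm) ?_ start
      hc.start_mem
    have := Summary.Agree.generalize (N := G.trip) (s := s) (S := S start)
      (T := round start (.keep s) post c S start) (ρ := ρ) (t := n - 1) (by omega)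
      fun t' h1 h2 => h.agree ρ t' h1 (by omega) (by omega)
    intro x
    simpa only [Summary.eval_shift, Summary.kept_shift, Nat.cast_pred h1] using this x
  · -- A position kept by the new summary in iteration `n + 1` is kept by the generalized one in
    -- iteration `n`, hence was not updated in iteration `n`.
    have h2 : (S start).kept ρ n x ≠ none := by
      intro h0
      have h3 := (Summary.generalize_of_last_update G.trip (.keep s) (S start) ρ n x
        (by exact_mod_cast (by omega : n ≤ G.trip)) n h1 le_rfl h0
        fun t₂ h4 h5 => by omega).2
      rcases hkept ρ (n + 1) x none (by omega) hn (.inl h3) with h4 | h4 <;> exact hk h4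
    rwa [(h.agree ρ n h1 (by omega) (by omega) x).2] at h2
  · exact hkept ρ n x _ h1 hn (Summary.kept_generalize _ _ _ _ _ _ (by omega))

/-- The exit condition holds as soon as all iterations have settled. -/
theorem Settled.equiv {s : I start.1} {S : G.Tensor}
    (h : Settled post c start s G.trip S) :
    Summary.Equiv G.trip (round start (.keep s) post c S start)
      (Summary.generalize G.trip (.keep s) (S start)) := by
  intro ρ n x h1 hn
  lift n to ℕ using by omega
  have h1' : 1 ≤ n := by exact_mod_cast h1
  have hn' : n ≤ G.trip := by exact_mod_cast hn
  rw [← (h.agree ρ n h1' hn' hn' x).1]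
  by_cases hk : (S start).kept ρ n x = none
  · exact (Summary.generalize_of_last_update _ _ _ ρ n x hn n h1' le_rfl hk
      fun t₂ h2 h3 => by omega).1.symm
  · have hall : ∀ j t₁ : ℕ, 1 ≤ t₁ → t₁ + j = n → (S start).kept ρ t₁ x ≠ none := by
      intro j
      induction j with
      | zero => rintro t₁ - rfl; exact hk
      | succ j ih =>
        intro t₁ h2 h3
        exact h.mono ρ t₁ x h2 (by omega) (by omega) (ih (t₁ + 1) (by omega) (by omega))
    rw [(Summary.generalize_of_forall_kept _ _ _ ρ n x hn fun t₁ h2 h3 =>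
      hall (n - t₁) t₁ h2 (by omega)).1, Summary.eval_keep]
    exact Summary.eval_of_kept ρ n x ((h.keep ρ n x h1' hn' hn').resolve_left hk)

/-- The repeat-until loop ends after at most `trip + 1` rounds. -/
theorem exists_repeatUntil_eq (hG : G.Regular) (hc : IsSweep start c) {s : I start.1}
    {S₀ : G.Tensor}
    (hout : ∀ v ∈ c, ∀ w ∉ c, G.Edge w v → ∀ ρ n x, (G.read none S₀ w.1 w.2).kept ρ n x = none)
    (k : ℕ) (S : G.Tensor) (hS : ∀ v ∉ c, S v = S₀ v)
    (h : Settled post c start s (G.trip - k) S) :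
    ∃ S' : G.Tensor, (∀ v ∉ c, S' v = S₀ v) ∧
      Summary.Equiv G.trip (round start (.keep s) post c S' start)
        (Summary.generalize G.trip (.keep s) (S' start)) ∧
      ∀ b, k + 1 ≤ b →
        G.repeatUntil start (.keep s) post c b S = some (round start (.keep s) post c S') := by
  have step : ∀ S : G.Tensor, ∀ b, 1 ≤ b → G.repeatUntil start (.keep s) post c b S =
      open Classical in
      if Summary.Equiv G.trip (round start (.keep s) post c S start)
        (Summary.generalize G.trip (.keep s) (S start)) then
        some (round start (.keep s) post c S)
      else G.repeatUntil start (.keep s) post c (b - 1) (round start (.keep s) post c S) := by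
    intro S b hb
    obtain ⟨b, rfl⟩ := Nat.exists_eq_add_of_le' hb
    rfl
  induction k generalizing S with
  | zero => exact ⟨S, hS, h.equiv, fun b hb => by rw [step S b hb, if_pos h.equiv]⟩
  | succ k ih =>
    by_cases he : Summary.Equiv G.trip (round start (.keep s) post c S start)
      (Summary.generalize G.trip (.keep s) (S start))
    · exact ⟨S, hS, he, fun b hb => by rw [step S b (by omega), if_pos he]⟩
    have hS' : ∀ v ∉ c, round start (.keep s) post c S v = S₀ v :=
      fun v hv => (round_of_notMem hc _ S hv).trans (hS v hv)
    have hsettled : Settled post c start s (G.trip - k) (round start (.keep s) post c S) := by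
      have h' := h.succ hG hc (fun v hv w hw hwv ρ n x => by
        have hwS : G.read none S w.1 w.2 = G.read none S₀ w.1 w.2 := by
          refine read_congr (by simp) (by simp) (hS w hw) fun init brs els hop => hS _ ?_
          exact fun h => hc.not_input _ h (hG.init_input w.2 init brs els hop)
        rw [hwS]
        exact hout v hv w hw hwv ρ n x)
      exact ⟨fun ρ n h1 h2 h3 => h'.agree ρ n h1 (by omega) h3,
        fun ρ n x h1 h2 h3 => h'.mono ρ n x h1 (by omega) h3,
        fun ρ n x h1 h2 h3 => h'.keep ρ n x h1 (by omega) h3⟩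
    obtain ⟨S', h1, h2, h3⟩ := ih _ hS' hsettled
    exact ⟨S', h1, h2, fun b hb => by
      rw [step S b (by omega), if_neg he, h3 (b - 1) (by omega)]⟩

/-- When the exit condition holds, the generalized summary denotes the value of the start vertex at
the end of every iteration, by induction on the iteration; then the last sweep is correct for all
vertices of the component. -/
theorem round_denotes (hG : G.Regular) (hc : IsSweep start c)
    {call : Env d J → Val d .arr} {val : ℕ → ∀ v : G.Vert, Val d v.1} {ρ : Env d I}
    (hval : G.IsTrace call ρ val)
    (hpost : ∀ v ∈ c, G.IsLoopcall v → ∀ ρ', (post v).Holds ρ' (call ρ'))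
    {S : G.Tensor} (hout : ∀ v ∈ c, ∀ w ∉ c, G.Edge w v → ∀ n : ℕ, 1 ≤ n → n ≤ G.trip →
      (G.read none S w.1 w.2).Denotes ρ n (G.readVal val n w.1 w.2))
    {s : I start.1} (hs : val 0 start = ρ start.1 s)
    (h : Summary.Equiv G.trip (round start (.keep s) post c S start)
      (Summary.generalize G.trip (.keep s) (S start)))
    {n : ℕ} (h1 : 1 ≤ n) (hn : n ≤ G.trip) : ∀ v ∈ c,
    (round start (.keep s) post c S v).Denotes ρ n (val n v) := by
  have step : ∀ n : ℕ, n + 1 ≤ G.trip →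
      (Summary.generalize G.trip (.keep s) (S start)).Denotes ρ n (val n start) →
      ∀ v ∈ c, (round start (.keep s) post c S v).Denotes ρ ((n + 1 : ℕ) : ℤ) (val (n + 1) v) := by
    intro n hn hgen
    refine forwardSweep_denotes hG hc hval hpost (by omega) hn
      (fun v hv w hw hwv => hout v hv w hw hwv _ (by omega) hn) fun x => ?_
    rw [Summary.eval_shift, Nat.cast_succ, add_sub_cancel_right, Nat.add_sub_cancel]
    exact hgen x
  have hgen : ∀ n : ℕ, n ≤ G.trip →
      (Summary.generalize G.trip (.keep s) (S start)).Denotes ρ n (val n start) := by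
    intro n
    induction n with
    | zero =>
      intro hn x
      rw [(Summary.generalize_of_forall_kept _ _ _ ρ _ x (by exact_mod_cast hn)
        fun t₁ h1 h2 => by omega).1, Summary.eval_keep, hs]
    | succ n ih =>
      intro hn x
      rw [← h ρ _ x (by omega) (by exact_mod_cast hn)]
      exact step n hn (ih (by omega)) start hc.start_mem x
  obtain ⟨n, rfl⟩ := Nat.exists_eq_add_of_le' h1
  exact step n hn (hgen n (by omega))

end Round

/-! ### Semantic extraction within a component -/

theorem Summarized.seal {val : Env d I → ℕ → ∀ v : G.Vert, Val d v.1} {S : G.Tensor} {v : G.Vert}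
    (h : Summarized val S v) : Summarized val (fun v => (S v).seal_) v where
  denotes ρ n h1 hn x := by rw [Summary.eval_seal]; exact h.denotes ρ n h1 hn x
  kept ρ n x := Summary.kept_seal ρ n x _
  input s hs := by
    rw [h.input s hs]
    rfl

section Extract

variable {c : List G.Vert} {post : G.Vert → Summary d J .arr} {call : Env d J → Val d .arr}
  {val : Env d I → ℕ → ∀ v : G.Vert, Val d v.1} {S : G.Tensor}

/-- A vertex that is not on a cycle is summarized by its rule. -/
theorem extract_of_trivial (hG : G.Regular) (hval : ∀ ρ, G.IsTrace call ρ (val ρ))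
    (hpost : ∀ v ∈ c, G.IsLoopcall v → ∀ ρ', (post v).Holds ρ' (call ρ'))
    (hS : ∀ v ∈ c, ∀ w ∉ c, G.Edge w v →
      Summarized val S w ∧ ∀ u, G.Edge u w → Summarized val S u)
    (ht : G.Trivial c) :
    ∃ S' : G.Tensor, (∀ b, G.extract b post c S = some S') ∧ (∀ v ∈ c, Summarized val S' v) ∧
      ∀ v ∉ c, Summarized val S v → Summarized val S' v := by
  classical
  have ht' := ht
  obtain ⟨v, rfl, hvv⟩ := ht
  have hS' : ∀ w, G.Edge w v → Summarized val S w ∧ ∀ u, G.Edge u w → Summarized val S u :=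
    fun w hwv => hS v (by simp) w (by rw [List.mem_singleton]; rintro rfl; exact hvv hwv) hwv
  refine ⟨G.applyRule none post S v, fun b => ?_, ?_, ?_⟩
  · simp [extract, ht']
  · intro w hw
    obtain rfl := List.mem_singleton.1 hw
    have hw' : G.applyRule none post S w w = (G.op w.2).rule (G.read none S) (post w) :=
      Function.update_self _ _ _
    refine ⟨fun ρ n h1 hn => ?_, fun ρ n x => ?_, fun s hs => ?_⟩
    · rw [hw', (hval ρ).step n h1 hn]
      exact Op.rule_denotes _ (hpost w hw) fun σ u hu =>
        read_denotes hG (hval ρ) (hS' _ hu).1 (hS' _ hu).2 h1 hn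
    · rw [hw']
      have := Op.kept_rule (ρ := ρ) (n := n) (x := x) (post := post w) (rd := G.read none S)
        (k := none) (G.op w.2) fun σ u hu => .inl (read_kept (hS' _ hu).1 (hS' _ hu).2 ρ n x)
      exact this.elim id id
    · rw [hw', hs]
      rfl
  · intro w hw h
    refine h.congr ?_
    exact Function.update_of_ne (by simpa using hw) _ _

/-- The iterative extraction summarizes all vertices of a component with a cycle. -/
theorem exists_extract_eq_of_isSweep (hG : G.Regular) (hval : ∀ ρ, G.IsTrace call ρ (val ρ))
    (hpost : ∀ v ∈ c, G.IsLoopcall v → ∀ ρ', (post v).Holds ρ' (call ρ'))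
    (hS : ∀ v ∈ c, ∀ w ∉ c, G.Edge w v →
      Summarized val S w ∧ ∀ u, G.Edge u w → Summarized val S u)
    {start : G.Vert} (hc : IsSweep start c) (ht : ¬ G.Trivial c) :
    ∃ S' : G.Tensor, (∀ b, G.trip + 1 ≤ b → G.extract b post c S = some S') ∧
      (∀ v ∈ c, Summarized val S' v) ∧
      ∀ v ∉ c, Summarized val S v → Summarized val S' v := by
  classical
  obtain ⟨init, brs, els, hop⟩ := hc.isLoopPhi
  obtain ⟨s, hs⟩ := hG.init_input start.2 init brs els hop
  have hinit : (⟨start.1, init⟩ : G.Vert) ∉ c := fun h => hc.not_input _ h ⟨s, hs⟩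
  have hSinit : S ⟨start.1, init⟩ = .inp s :=
    (hS start hc.start_mem _ hinit (edge_init hop)).1.input s hs
  have hread : ∀ S' : G.Tensor, (∀ v ∉ c, S' v = S v) → ∀ w ∉ c,
      G.read none S' w.1 w.2 = G.read none S w.1 w.2 := fun S' hS' w hw =>
    read_congr (by simp) (by simp) (hS' w hw) fun init brs els hop => hS' _
      fun h => hc.not_input _ h (hG.init_input w.2 init brs els hop)
  obtain ⟨S', h1, h2, h3⟩ := exists_repeatUntil_eq (post := post) (s := s) (S₀ := S) hG hc
    (fun v hv w hw hwv ρ n x => read_kept (hS v hv w hw hwv).1 (hS v hv w hw hwv).2 ρ n x)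
    G.trip (G.forwardSweep start post c (Function.update S start (.keep s)))
    (fun v hv => forwardSweep_update_of_notMem hc S _ v hv)
    (by rw [Nat.sub_self]; exact Settled.zero s _)
  refine ⟨fun v => (round start (.keep s) post c S' v).seal_, fun b hb => ?_, ?_, ?_⟩
  · have hlast : c.getLast? = some start := by
      obtain ⟨l, rfl⟩ := hc.last
      simp
    unfold extract
    rw [hlast]
    simp only [if_neg ht]
    split
    · next i' b' e' h' =>
      rw [hop] at h'
      cases h'
      rw [hSinit]
      change (G.repeatUntil start (.keep s) post c b
        (G.forwardSweep start post c (Function.update S start (.keep s)))).map _ = _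
      rw [h3 b hb]
      rfl
    · next h' => exact absurd hop (h' _ _ _)
  · intro v hv
    refine ⟨fun ρ n h4 h5 x => ?_, fun ρ n x => Summary.kept_seal ρ n x _, fun s hs => ?_⟩
    · rw [Summary.eval_seal]
      refine round_denotes hG hc (hval ρ) hpost ?_
        ((hval ρ).entry start.2 init brs els s hop hs) h2 h4 h5 v hv x
      intro v hv w hw hwv n h6 h7
      rw [hread S' h1 w hw]
      exact read_denotes hG (hval ρ) (hS v hv w hw hwv).1 (hS v hv w hw hwv).2 h6 h7
    · exact absurd ⟨s, hs⟩ (hc.not_input v hv)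
  · intro v hv h
    exact Summarized.seal (h.congr ((round_of_notMem hc _ S' hv).trans (h1 v hv)))

end Extract

end DepGraph

end StencilLifting

namespace StencilLifting

namespace DepGraph

variable {d : ℕ} {I J : Ty → Type} {G : DepGraph d I J}

/-! ### The algorithm at one level -/

theorem SameSCC.symm {u v : G.Vert} (h : G.SameSCC u v) : G.SameSCC v u := ⟨h.2, h.1⟩

theorem SameSCC.trans {u v w : G.Vert} (h : G.SameSCC u v) (h' : G.SameSCC v w) :
    G.SameSCC u w := ⟨h.1.trans h'.1, h'.2.trans h.2⟩

section Sequence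

variable {Ω : List (List G.Vert)}

theorem IsSequence.exists_isSweep (hΩ : G.IsSequence Ω)
    (hs : ∀ u v, G.IsLoopPhi u → G.IsLoopPhi v → G.SameSCC u v → u = v) {c : List G.Vert}
    (hc : c ∈ Ω) (ht : ¬ G.Trivial c) : ∃ start, IsSweep start c := by
  obtain ⟨l, start, hl, hphi, hord⟩ := hΩ.sweep c hc ht
  obtain ⟨v₀, hv₀⟩ := hΩ.isSCC c hc
  have hstart : start ∈ c := by simp [hl]
  have hscc : ∀ w ∈ c, G.SameSCC start w := fun w hw =>
    ((hv₀ start).1 hstart).symm.trans ((hv₀ w).1 hw)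
  refine ⟨start, (List.nodup_flatten.1 hΩ.nodup).1 c hc, ⟨l, hl⟩, hphi,
    fun w hw hp => (hs _ _ hphi hp (hscc w hw)).symm, fun w hw hin => ?_, ?_⟩
  · rcases (Relation.ReflTransGen.cases_tail (hscc w hw).1) with rfl | ⟨u, -, huw⟩
    · exact not_isLoopPhi_of_input hin hphi
    · exact not_edge_of_input hin huw
  · rw [hl, List.pairwise_append]
    refine ⟨hord.imp (S := fun a b => b ≠ start → ¬ G.Edge b a) fun h _ => h, List.pairwise_singleton _ _, fun a _ b hb hne => ?_⟩
    exact absurd (List.mem_singleton.1 hb) hne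

/-- An initial segment of the sequence contains all predecessors of its vertices. -/
theorem IsSequence.mem_of_edge (hΩ : G.IsSequence Ω) {pre suf : List (List G.Vert)}
    (h : Ω = pre ++ suf) {u v : G.Vert} (hv : v ∈ pre.flatten) (huv : G.Edge u v) :
    u ∈ pre.flatten := by
  have hu := hΩ.cover u
  rw [h, List.flatten_append, List.mem_append] at hu
  refine hu.resolve_right fun hu => ?_
  obtain ⟨c, hc, hvc⟩ := List.mem_flatten.1 hv
  obtain ⟨c', hc', huc⟩ := List.mem_flatten.1 hu
  have htop := hΩ.topological
  rw [h, List.pairwise_append] at htop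
  exact htop.2.2 c hc c' hc' v hvc u huc huv

end Sequence

theorem exists_initLoopcalls_eq {callee : Option (Summary d J .arr)} {pc : Summary d J .arr}
    (hcallee : (∃ v, G.IsLoopcall v) → callee = some pc) (c : List G.Vert) (st : G.Store) :
    ∃ st' : G.Store, G.initLoopcalls callee c st = some st' ∧
      (∀ v ∉ c, st'.S v = st.S v) ∧
      ∀ v, G.IsLoopcall v → (v ∈ c ∨ st.post v = pc) → st'.post v = pc := by
  classical
  induction c generalizing st with
  | nil => exact ⟨st, rfl, fun _ _ => rfl, fun v _ h => h.resolve_left (by simp)⟩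
  | cons a c ih =>
    by_cases ha : G.IsLoopcall a
    · obtain ⟨st', h1, h2, h3⟩ := ih
        { S := G.applyRule none (Function.update st.post a pc) st.S a,
          post := Function.update st.post a pc }
      refine ⟨st', ?_, fun v hv => ?_, fun v hv hvc => h3 v hv ?_⟩
      · rw [← h1, hcallee ⟨a, ha⟩]
        simp [initLoopcalls, ha]
      · rw [List.mem_cons, not_or] at hv
        rw [h2 v hv.2]
        exact Function.update_of_ne hv.1 _ _
      · rcases eq_or_ne v a with rfl | hne
        · exact .inr (Function.update_self _ _ _)
        · rcases hvc with hvc | hvc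
          · exact .inl ((List.mem_cons.1 hvc).resolve_left hne)
          · exact .inr ((Function.update_of_ne hne _ _).trans hvc)
    · obtain ⟨st', h1, h2, h3⟩ := ih st
      refine ⟨st', ?_, fun v hv => h2 v fun h => hv (by simp [h]), fun v hv hvc => h3 v hv ?_⟩
      · rw [← h1]
        simp [initLoopcalls, ha]
      · refine hvc.imp_left fun h => (List.mem_cons.1 h).resolve_left ?_
        rintro rfl
        exact ha hv

/-- Correctness of the algorithm at one level: with a postcondition `pc` of the loop one level below,
every repeat-until loop ends after at most `trip + 1` rounds, and the result is a summary of the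
output array after the last iteration. -/
theorem exists_liftLevel_eq (hG : G.Regular)
    (hs : ∀ u v, G.IsLoopPhi u → G.IsLoopPhi v → G.SameSCC u v → u = v) (htrip : 1 ≤ G.trip)
    {call : Env d J → Val d .arr} {val : Env d I → ℕ → ∀ v : G.Vert, Val d v.1}
    (hval : ∀ ρ, G.IsTrace call ρ (val ρ)) {callee : Option (Summary d J .arr)}
    {pc : Summary d J .arr} (hcallee : (∃ v, G.IsLoopcall v) → callee = some pc)
    (hpc : (∃ v, G.IsLoopcall v) → ∀ ρ', pc.Holds ρ' (call ρ'))
    {Ω : List (List G.Vert)} (hΩ : G.IsSequence Ω) (S₀ : G.Tensor) :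
    ∃ post : Summary d I .arr, (∀ b, G.trip + 1 ≤ b → G.liftLevel b callee Ω S₀ = some post) ∧
      ∀ ρ, post.Holds ρ (val ρ G.trip ⟨.arr, G.out⟩) := by
  classical
  have key : ∀ suf pre : List (List G.Vert), Ω = pre ++ suf → ∀ st : G.Store,
      (∀ v ∈ pre.flatten, Summarized val st.S v) →
      ∃ st' : G.Store, (∀ b, G.trip + 1 ≤ b →
        suf.foldlM (fun (st : G.Store) c => do
          let st' ← G.initLoopcalls callee c st
          let S' ← G.extract b st'.post c st'.S
          some { S := S', post := st'.post }) st = some st') ∧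
        ∀ v, Summarized val st'.S v := by
    intro suf
    induction suf with
    | nil =>
      intro pre h st hst
      refine ⟨st, fun b _ => rfl, fun v => hst v ?_⟩
      have := hΩ.cover v
      rwa [h, List.append_nil] at this
    | cons c suf ih =>
      intro pre h st hst
      have hcΩ : c ∈ Ω := by simp [h]
      have h' : Ω = (pre ++ [c]) ++ suf := by simp [h]
      have hdisj : ∀ v ∈ pre.flatten, v ∉ c := by
        have := hΩ.nodup
        rw [h, List.flatten_append, List.flatten_cons, List.nodup_append] at this
        exact fun v hv hvc => this.2.2 v hv v (by simp [hvc]) rfl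
      obtain ⟨st₁, h1, h2, h3⟩ := exists_initLoopcalls_eq hcallee c st
      have hst₁ : ∀ v ∈ pre.flatten, Summarized val st₁.S v :=
        fun v hv => (hst v hv).congr (h2 v (hdisj v hv))
      have hpost : ∀ v ∈ c, G.IsLoopcall v → ∀ ρ', (st₁.post v).Holds ρ' (call ρ') := by
        intro v hv hcall
        rw [h3 v hcall (.inl hv)]
        exact hpc ⟨v, hcall⟩
      have hS : ∀ v ∈ c, ∀ w ∉ c, G.Edge w v →
          Summarized val st₁.S w ∧ ∀ u, G.Edge u w → Summarized val st₁.S u := by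
        intro v hv w hw hwv
        have hwpre : w ∈ pre.flatten := by
          have := hΩ.mem_of_edge h' (v := v) (by simp [hv]) hwv
          rw [List.flatten_append, List.mem_append] at this
          exact this.resolve_right (by simpa using hw)
        exact ⟨hst₁ w hwpre, fun u hu => hst₁ u (hΩ.mem_of_edge h hwpre hu)⟩
      obtain ⟨S', h4, h5, h6⟩ : ∃ S' : G.Tensor,
          (∀ b, G.trip + 1 ≤ b → G.extract b st₁.post c st₁.S = some S') ∧
          (∀ v ∈ c, Summarized val S' v) ∧
          ∀ v ∉ c, Summarized val st₁.S v → Summarized val S' v := by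
        by_cases ht : G.Trivial c
        · obtain ⟨S', h4, h5⟩ := extract_of_trivial hG hval hpost hS ht
          exact ⟨S', fun b _ => h4 b, h5⟩
        · obtain ⟨start, hc⟩ := hΩ.exists_isSweep hs hcΩ ht
          exact exists_extract_eq_of_isSweep hG hval hpost hS hc ht
      obtain ⟨st', h7, h8⟩ := ih (pre ++ [c]) h' { S := S', post := st₁.post } (by
        intro v hv
        rw [List.flatten_append, List.mem_append] at hv
        rcases hv with hv | hv
        · exact h6 v (hdisj v hv) (hst₁ v hv)
        · exact h5 v (by simpa using hv))
      refine ⟨st', fun b hb => ?_, h8⟩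
      rw [List.foldlM_cons, h1]
      simp only [Option.bind_eq_bind, Option.bind_some, h4 b hb]
      exact h7 b hb
  obtain ⟨st', h1, h2⟩ := key Ω [] rfl _ (by simp)
  refine ⟨(st'.S ⟨.arr, G.out⟩).at_ (.ilit G.trip), fun b hb => ?_, fun ρ n x => ?_⟩
  · unfold liftLevel
    exact congrArg (Option.map _) (h1 b hb)
  · rw [Summary.eval_at_]
    exact ((h2 ⟨.arr, G.out⟩).denotes ρ G.trip htrip le_rfl x).symm

/-! ### Existence of a sequence of components -/

open Relation

/-- The number of ancestors of a vertex. -/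
noncomputable def ancestors (G : DepGraph d I J) (v : G.Vert) : ℕ :=
  {u | ReflTransGen G.Edge u v}.ncard

theorem sameSCC_of_ancestors_le (hG : G.Regular) {u v : G.Vert} (h : ReflTransGen G.Edge u v)
    (hle : G.ancestors v ≤ G.ancestors u) : G.SameSCC u v := by
  have := hG.finite
  refine ⟨h, ?_⟩
  have heq : {w | ReflTransGen G.Edge w u} = {w | ReflTransGen G.Edge w v} :=
    Set.eq_of_subset_of_ncard_le (fun _ hw => ReflTransGen.trans hw h) hle (Set.toFinite _)
  have hv : v ∈ {w | ReflTransGen G.Edge w v} := ReflTransGen.refl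
  rwa [← heq] at hv

/-- A component without loop-carried variables is trivial. -/
theorem exists_isLoopPhi_of_not_trivial (hG : G.Regular) {c : List G.Vert} (hnd : c.Nodup)
    {v₀ : G.Vert} (hc : ∀ w, w ∈ c ↔ G.SameSCC v₀ w) (ht : ¬ G.Trivial c) :
    ∃ w ∈ c, G.IsLoopPhi w := by
  by_contra! hno
  obtain ⟨rank, hrank⟩ := hG.exists_rank
  have hlt : ∀ u ∈ c, ∀ w, ReflTransGen G.Edge u w → w ∈ c → rank u ≤ rank w ∧
      (u ≠ w → rank u < rank w) := by
    intro u hu w huw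
    induction huw with
    | refl => exact fun _ => ⟨le_rfl, fun h => absurd rfl h⟩
    | @tail w' w huw' hw'w ih =>
      intro hw
      have hw' : w' ∈ c := by
        have h1 := (hc u).1 hu
        have h2 := (hc w).1 hw
        exact (hc w').2 ⟨h1.1.trans huw', (ReflTransGen.single hw'w).trans h2.2⟩
      have := (ih hw').1.trans_lt (hrank w' w hw'w (hno w' hw'))
      exact ⟨this.le, fun _ => this⟩
  have hv₀ : v₀ ∈ c := (hc v₀).2 ⟨.refl, .refl⟩
  refine ht ⟨v₀, ?_, fun h => lt_irrefl _ (hrank v₀ v₀ h (hno v₀ hv₀))⟩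
  have hall : ∀ w ∈ c, w = v₀ := by
    intro w hw
    by_contra hne
    have h := (hc w).1 hw
    exact lt_asymm ((hlt v₀ hv₀ w h.1 hw).2 (Ne.symm hne)) ((hlt w hw v₀ h.2 hv₀).2 hne)
  cases c with
  | nil => simp at hv₀
  | cons a c =>
    obtain rfl := hall a (by simp)
    rw [List.nodup_cons] at hnd
    cases c with
    | nil => rfl
    | cons b c =>
      obtain rfl := hall b (by simp)
      simp at hnd

theorem exists_list_sorted {α : Type*} (f : α → ℕ) (l : List α) :
    ∃ l' : List α, l'.Perm l ∧ l'.Pairwise fun a b => f a ≤ f b := by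
  refine ⟨l.insertionSort fun a b => f a ≤ f b, List.perm_insertionSort _ _, ?_⟩
  have : Std.Total fun a b : α => f a ≤ f b := ⟨fun a b => le_total (f a) (f b)⟩
  have : IsTrans α fun a b : α => f a ≤ f b := ⟨fun _ _ _ => le_trans⟩
  exact List.pairwise_insertionSort _ _

/-- Every component has an admissible sweep order: its vertices sorted by rank, with the start vertex
moved to the end. -/
theorem exists_sweep_order (hG : G.Regular)
    (hs : ∀ u v, G.IsLoopPhi u → G.IsLoopPhi v → G.SameSCC u v → u = v) (v₀ : G.Vert) :
    ∃ c : List G.Vert, c.Nodup ∧ (∀ w, w ∈ c ↔ G.SameSCC v₀ w) ∧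
      (¬ G.Trivial c → ∃ l start, c = l ++ [start] ∧ G.IsLoopPhi start ∧
        l.Pairwise fun a b => ¬ G.Edge b a) := by
  classical
  have := hG.finite
  have := Fintype.ofFinite G.Vert
  obtain ⟨rank, hrank⟩ := hG.exists_rank
  obtain ⟨c, hperm, hsort⟩ :=
    exists_list_sorted rank (Finset.univ.filter fun w => G.SameSCC v₀ w).toList
  have hnd : c.Nodup := hperm.nodup_iff.2 (Finset.nodup_toList _)
  have hmem : ∀ w, w ∈ c ↔ G.SameSCC v₀ w := by simp [hperm.mem_iff]
  by_cases ht : G.Trivial c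
  · exact ⟨c, hnd, hmem, fun h => absurd ht h⟩
  obtain ⟨start, hstart, hphi⟩ := exists_isLoopPhi_of_not_trivial hG hnd hmem ht
  have hperm' : (c.erase start ++ [start]).Perm c :=
    (List.perm_append_singleton _ _).trans (List.perm_cons_erase hstart).symm
  refine ⟨c.erase start ++ [start], hperm'.nodup_iff.2 hnd,
    fun w => (hperm'.mem_iff).trans (hmem w), fun _ => ⟨_, _, rfl, hphi, ?_⟩⟩
  refine (hsort.sublist List.erase_sublist).imp_of_mem fun {a b} ha hb hab hba => ?_
  refine absurd (hrank b a hba fun hp => ?_) hab.not_gt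
  rw [hnd.mem_erase_iff] at hb
  exact hb.1 (hs _ _ hp hphi (((hmem b).1 hb.2).symm.trans ((hmem start).1 hstart)))

/-- A topological order of the components: they are sorted by their number of ancestors. -/
theorem exists_isSequence (hG : G.Regular)
    (hs : ∀ u v, G.IsLoopPhi u → G.IsLoopPhi v → G.SameSCC u v → u = v) :
    ∃ Ω, G.IsSequence Ω := by
  classical
  have := hG.finite
  let scc : Setoid G.Vert := ⟨G.SameSCC, fun _ => ⟨.refl, .refl⟩, SameSCC.symm, SameSCC.trans⟩
  have := Fintype.ofFinite (Quotient scc)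
  choose comp hnd hmem hsweep using exists_sweep_order hG hs
  obtain ⟨q, hperm, hsort⟩ := exists_list_sorted (fun a : Quotient scc => G.ancestors a.out)
    Finset.univ.toList
  have hq : ∀ a, a ∈ q := by simp [hperm.mem_iff]
  have hqnd : q.Nodup := hperm.nodup_iff.2 (Finset.nodup_toList _)
  have hcomp : ∀ (a : Quotient scc) v, v ∈ comp a.out ↔ Quotient.mk scc v = a := by
    intro a v
    rw [hmem]
    constructor
    · intro h
      rw [← a.out_eq]
      exact Quotient.sound h.symm
    · rintro rfl
      exact Quotient.mk_out (s := scc) v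
  have hne : q.Pairwise (· ≠ ·) := hqnd
  refine ⟨q.map fun a => comp a.out, ?_, ?_, ?_, ?_, ?_⟩
  · intro c hc
    obtain ⟨a, -, rfl⟩ := List.mem_map.1 hc
    exact ⟨_, hmem _⟩
  · intro v
    exact List.mem_flatten.2 ⟨_, List.mem_map.2 ⟨Quotient.mk scc v, hq _, rfl⟩, (hcomp _ v).2 rfl⟩
  · refine List.nodup_flatten.2 ⟨fun c hc => ?_, List.pairwise_map.2 (hne.imp ?_)⟩
    · obtain ⟨a, -, rfl⟩ := List.mem_map.1 hc
      exact hnd _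
    · intro a b hab v hva hvb
      exact hab (((hcomp a v).1 hva).symm.trans ((hcomp b v).1 hvb))
  · refine List.pairwise_map.2 ((hsort.and hne).imp ?_)
    rintro a b ⟨hle, hab⟩ u hu v hv hvu
    have hu' := (hmem _ _).1 hu
    have hv' := (hmem _ _).1 hv
    have hba : ReflTransGen G.Edge b.out a.out :=
      hv'.1.trans ((ReflTransGen.single hvu).trans hu'.2)
    refine hab ?_
    rw [← a.out_eq, ← b.out_eq]
    exact Quotient.sound (sameSCC_of_ancestors_le hG hba hle).symm
  · intro c hc
    obtain ⟨a, -, rfl⟩ := List.mem_map.1 hc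
    exact hsweep _

end DepGraph

end StencilLifting

namespace StencilLifting

/-! ### Execution of a loop and its invariant graph -/

namespace Op

variable {d : ℕ} {I J V V' : Ty → Type} {τ : Ty}

theorem exists_of_map_eq_loopPhi {g : ∀ σ, V σ → V' σ} {o : Op d I J V τ} {init' : V' τ}
    {brs' els'} (h : o.map g = .loopPhi init' brs' els') :
    ∃ init brs els, o = .loopPhi init brs els ∧ init' = g _ init := by
  cases o <;> simp only [map, reduceCtorEq, loopPhi.injEq] at h
  exact ⟨_, _, _, rfl, h.1.symm⟩

end Op

namespace LoopCode

variable {d : ℕ} {I J : Ty → Type} (L : LoopCode d I J)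

/-- In an iteration, every statement reads the values at the end of the iteration, or at the end of
the previous one for loop-carried variables. -/
theorem iterate_apply (ρ : Env d I) (call : Env d J → Val d .arr) (n : ℤ)
    (prev : ∀ v : L.Vert, Val d v.1) (v : L.Vert) :
    open Classical in
    L.iterate ρ call n prev v = (L.op v.2).eval ρ n
      (fun σ w => if L.IsLoopPhi ⟨σ, w⟩ then prev ⟨σ, w⟩ else L.iterate ρ call n prev ⟨σ, w⟩)
      call := by
  classical
  obtain ⟨l₁, l₂, hl⟩ := List.append_of_mem (L.mem_body v)
  obtain ⟨cur, h1, h2, -⟩ := exists_foldl_update_eq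
    (fun (cur : ∀ v : L.Vert, Val d v.1) (v : L.Vert) => (L.op v.2).eval ρ n
      (fun σ w => if L.IsLoopPhi ⟨σ, w⟩ then prev ⟨σ, w⟩ else cur ⟨σ, w⟩) call)
    L.body_nodup hl prev
  refine h1.trans (Op.eval_congr _ fun σ w hw => ?_)
  by_cases hp : L.IsLoopPhi ⟨σ, w⟩
  · rw [if_pos hp, if_pos hp]
  · rw [if_neg hp, if_neg hp]
    refine h2 _ ?_
    obtain ⟨l₁', l₂', hl', hw'⟩ := L.def_before_use _ v hw hp
    have hnd := L.body_nodup
    have hidx : ∀ l l' : List L.Vert, L.body = l ++ v :: l' → L.body.idxOf v = l.length := by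
      intro l l' h
      rw [h] at hnd ⊢
      have hv : v ∉ l := fun h => (List.nodup_append.1 hnd).2.2 _ h _ (by simp) rfl
      rw [List.idxOf_append_of_notMem hv, List.idxOf_cons_self, add_zero]
    have : l₁' = l₁ := List.append_inj_left (hl'.symm.trans hl)
      ((hidx _ _ hl').symm.trans (hidx _ _ hl))
    rwa [← this]

/-- The execution of a loop is a trace of its own dependency graph. -/
theorem isTrace_state (ρ : Env d I) (call : Env d J → Val d .arr) :
    L.toDepGraph.IsTrace call ρ (L.state ρ call) where
  step n h1 _ v := by
    obtain ⟨n, rfl⟩ := Nat.exists_eq_add_of_le' h1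
    have := L.iterate_apply ρ call ((n + 1 : ℕ) : ℤ) (L.state ρ call n) v
    have hn : L.state ρ call (n + 1) = L.iterate ρ call ((n + 1 : ℕ) : ℤ) (L.state ρ call n) := by
      rw [Nat.cast_succ]; rfl
    rw [← hn] at this
    exact this
  entry {τ} v init brs els s hv hi := by
    change L.entry ρ call ⟨τ, v⟩ = _
    unfold entry
    split
    · next i' b' e' h' =>
      change L.op v = _ at h'
      rw [hv] at h'
      cases h'
      rw [hi]
      rfl
    · next h' => exact absurd hv (h' _ _ _)

end LoopCode

namespace IsInvariantSubgraph

variable {d : ℕ} {I J : Ty → Type} {M : ℕ} {L : LoopCode d I J} {G : DepGraph d I J}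

open Classical in
/-- The invariant graph in terms of one invocation of the loop: the slice of iteration `n` is mapped
by `F n`, and operands are read from the same or from the preceding slice. -/
theorem exists_slice_map (h : IsInvariantSubgraph M L G) (hM : 1 ≤ M) :
    ∃ F : ℕ → ∀ τ, L.V τ → G.V τ,
      (∀ n, 1 ≤ n → n ≤ L.trip → ∀ τ, Function.Bijective (F n τ)) ∧
      (∀ n, 1 ≤ n → n ≤ L.trip → ∀ τ (v : L.V τ), G.op (F n τ v) =
        (L.op v).map fun σ u => F (if L.IsLoopPhi ⟨σ, u⟩ then n - 1 else n) σ u) ∧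
      F L.trip .arr L.out = G.out ∧
      ∀ τ (v : L.V τ), L.IsLoopPhi ⟨τ, v⟩ → F 0 τ v = F 1 τ v := by
  obtain ⟨-, f, hf⟩ := h
  obtain ⟨h1, h2⟩ := hf 1 le_rfl hM
  refine ⟨fun n τ v => f τ ⟨1, n, v⟩, fun n hn hn' => (h1 n hn hn').1, fun n hn hn' τ v => ?_,
    (h1 L.trip L.trip_pos le_rfl).2.2, h2⟩
  rw [(h1 n hn hn').2.1, LoopCode.smgOp, Op.map_map]

/-- The invariant graph is isomorphic to the dependency graph of the loop. -/
theorem exists_equiv (h : IsInvariantSubgraph M L G) (hM : 1 ≤ M) :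
    ∃ e : ∀ τ, L.V τ ≃ G.V τ, ∀ τ (v : L.V τ), G.op (e τ v) = (L.op v).map fun σ u => e σ u := by
  classical
  obtain ⟨F, hbij, hop, -, h0⟩ := h.exists_slice_map hM
  refine ⟨fun τ => Equiv.ofBijective _ (hbij 1 le_rfl L.trip_pos τ), fun τ v => ?_⟩
  refine (hop 1 le_rfl L.trip_pos τ v).trans (congrArg (fun g => (L.op v).map g) ?_)
  funext σ u
  by_cases hp : L.IsLoopPhi ⟨σ, u⟩
  · rw [if_pos hp]; exact h0 σ u hp
  · rw [if_neg hp]; rfl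

theorem regular (h : IsInvariantSubgraph M L G) (hM : 1 ≤ M) : G.Regular := by
  classical
  obtain ⟨e, he⟩ := h.exists_equiv hM
  let E : L.Vert ≃ G.Vert := Equiv.sigmaCongrRight e
  refine ⟨?_, ?_, fun v => L.body.idxOf (E.symm v), ?_⟩
  · have : Finite L.Vert :=
      Set.finite_univ_iff.1 ((L.body.finite_toSet).subset fun v _ => L.mem_body v)
    exact Finite.of_equiv _ E
  · intro τ v init brs els hv
    obtain ⟨v, rfl⟩ := (e τ).surjective v
    rw [he] at hv
    obtain ⟨i, b, l, hv', rfl⟩ := Op.exists_of_map_eq_loopPhi hv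
    obtain ⟨s, hs⟩ := L.init_input v i b l hv'
    exact ⟨s, by rw [he, hs]; rfl⟩
  · intro w v hwv hp
    obtain ⟨w, rfl⟩ := E.surjective w
    obtain ⟨v, rfl⟩ := E.surjective v
    obtain ⟨τ, v⟩ := v
    have hwv' : (G.op (e τ v)).Uses (E w) := hwv
    rw [he, Op.uses_map] at hwv'
    obtain ⟨u, hu, huw⟩ := hwv'
    obtain rfl : w = u := E.injective huw
    have hpw : ¬ L.IsLoopPhi w := fun hpw => hp <| by
      change (G.op (e w.1 w.2)).IsLoopPhi
      rw [he]
      exact (Op.isLoopPhi_map _ _).2 hpw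
    obtain ⟨l₁, l₂, hl, hw⟩ := L.def_before_use w ⟨τ, v⟩ hu hpw
    have hnd := L.body_nodup
    rw [hl] at hnd
    have hv : (⟨τ, v⟩ : L.Vert) ∉ l₁ := fun h => (List.nodup_append.1 hnd).2.2 _ h _ (by simp) rfl
    change L.body.idxOf (E.symm (E w)) < L.body.idxOf (E.symm (E ⟨τ, v⟩))
    rw [Equiv.symm_apply_apply, Equiv.symm_apply_apply, hl, List.idxOf_append_of_mem hw,
      List.idxOf_append_of_notMem hv]
    exact (List.idxOf_lt_length_of_mem hw).trans_le (Nat.le_add_right _ _)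

theorem exists_isLoopcall_iff (h : IsInvariantSubgraph M L G) (hM : 1 ≤ M) :
    (∃ v, G.IsLoopcall v) ↔ ∃ v, L.IsLoopcall v := by
  obtain ⟨e, he⟩ := h.exists_equiv hM
  have key : ∀ τ (v : L.V τ), G.IsLoopcall ⟨τ, e τ v⟩ ↔ L.IsLoopcall ⟨τ, v⟩ := fun τ v => by
    change (G.op (e τ v)).IsLoopcall ↔ _
    rw [he]
    exact Op.isLoopcall_map _ _
  constructor
  · rintro ⟨⟨τ, v⟩, hv⟩
    obtain ⟨v, rfl⟩ := (e τ).surjective v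
    exact ⟨⟨τ, v⟩, (key τ v).1 hv⟩
  · rintro ⟨⟨τ, v⟩, hv⟩
    exact ⟨⟨τ, e τ v⟩, (key τ v).2 hv⟩

/-- Every execution of the loop is a trace of the invariant graph: the value of a vertex in iteration
`n` is that of the variable which the slice of iteration `n` maps to it. This variable may depend on
`n`, since an invariant graph may have automorphisms. -/
theorem exists_isTrace (h : IsInvariantSubgraph M L G) (hM : 1 ≤ M)
    (call : Env d J → Val d .arr) (ρ : Env d I) :
    ∃ val, G.IsTrace call ρ val ∧ val G.trip ⟨.arr, G.out⟩ = L.run call ρ := by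
  classical
  obtain ⟨F, hbij, hop, hout, h0⟩ := h.exists_slice_map hM
  have htrip := h.1
  have hinv : ∀ n, ∃ inv : ∀ τ, G.V τ → L.V τ,
      n ≤ L.trip → ∀ τ v, inv τ (F (max n 1) τ v) = v := by
    intro n
    by_cases hn : n ≤ L.trip
    · have hb := hbij (max n 1) (le_max_right _ _) (max_le hn L.trip_pos)
      exact ⟨fun τ => (Equiv.ofBijective _ (hb τ)).symm,
        fun _ τ v => (Equiv.ofBijective _ (hb τ)).symm_apply_apply v⟩
    · exact ⟨fun τ => (Equiv.ofBijective _ (hbij 1 le_rfl L.trip_pos τ)).symm,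
        fun hn' => absurd hn' hn⟩
  choose inv hinv using hinv
  set val : ℕ → ∀ v : G.Vert, Val d v.1 :=
    fun n v => L.state ρ call n ⟨v.1, inv n v.1 v.2⟩
  have hvalF : ∀ n, n ≤ L.trip → ∀ τ (v : L.V τ),
      val n ⟨τ, F (max n 1) τ v⟩ = L.state ρ call n ⟨τ, v⟩ := by
    intro n hn τ v
    exact congrArg (α := L.V τ) (β := Val d τ) (fun u => L.state ρ call n ⟨τ, u⟩) (hinv n hn τ v)
  have hphi : ∀ n, n ≤ L.trip → ∀ τ (v : L.V τ),
      G.IsLoopPhi ⟨τ, F (max n 1) τ v⟩ ↔ L.IsLoopPhi ⟨τ, v⟩ := by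
    intro n hn τ v
    change (G.op (F (max n 1) τ v)).IsLoopPhi ↔ _
    rw [hop _ (le_max_right _ _) (max_le hn L.trip_pos)]
    exact Op.isLoopPhi_map _ _
  have hL := L.isTrace_state ρ call
  refine ⟨val, ⟨fun n h1 hn v => ?_, fun {τ} v init brs els s hv hi => ?_⟩, ?_⟩
  · rw [htrip] at hn
    obtain ⟨τ, v⟩ := v
    obtain ⟨v, rfl⟩ := (hbij n h1 hn τ).surjective v
    have hv := hvalF n hn τ v
    rw [max_eq_left h1] at hv
    rw [hv, hL.step n h1 hn, hop n h1 hn, Op.eval_map]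
    refine Op.eval_congr _ fun σ u _ => ?_
    by_cases hp : L.IsLoopPhi ⟨σ, u⟩
    · -- At loop entry, a loop-carried variable goes to the same vertex as in iteration `1`.
      have hF : F (n - 1) σ u = F (max (n - 1) 1) σ u := by
        rcases eq_or_lt_of_le h1 with rfl | h1
        · exact h0 σ u hp
        · rw [max_eq_left (by omega)]
      have hp' := (hphi (n - 1) (by omega) σ u).2 hp
      have hv' := hvalF (n - 1) (by omega) σ u
      rw [if_pos hp, hF, DepGraph.readVal, if_pos hp, DepGraph.readVal, if_pos hp', hv']
    · have hp' := fun h => hp ((hphi n hn σ u).1 h)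
      have hv' := hvalF n hn σ u
      rw [max_eq_left h1] at hp' hv'
      rw [if_neg hp, DepGraph.readVal, if_neg hp, DepGraph.readVal, if_neg hp', hv']
  · obtain ⟨v, rfl⟩ := (hbij 1 le_rfl L.trip_pos τ).surjective v
    rw [hop 1 le_rfl L.trip_pos] at hv
    obtain ⟨i, b, l, hv', rfl⟩ := Op.exists_of_map_eq_loopPhi hv
    obtain ⟨s', hs'⟩ := L.init_input v i b l hv'
    have hni : ¬ L.IsLoopPhi ⟨τ, i⟩ := DepGraph.not_isLoopPhi_of_input ⟨s', hs'⟩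
    rw [if_neg hni, hop 1 le_rfl L.trip_pos, hs'] at hi
    obtain rfl : s' = s := by simpa [Op.map] using hi
    have := hvalF 0 (by omega) τ v
    rw [max_eq_right zero_le_one] at this
    rw [this]
    exact hL.entry v i b l s' hv' hs'
  · rw [htrip, ← hout]
    have := hvalF L.trip le_rfl .arr L.out
    rwa [max_eq_left L.trip_pos] at this

end IsInvariantSubgraph

/-! ### Correctness of the hierarchical recursive lifting -/

theorem LoopCode.callCount_pos {d : ℕ} {I J : Ty → Type} (L : LoopCode d I J)
    (h : ∃ v, L.IsLoopcall v) : 1 ≤ L.callCount := by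
  classical
  obtain ⟨v, hv⟩ := h
  exact List.length_pos_of_mem (List.mem_filter.2 ⟨L.mem_body v, by simpa using hv⟩)

/-- Correctness of the algorithm at one level, in terms of the loop. -/
theorem IsInvariantSubgraph.exists_liftLevel_eq {d : ℕ} {I J : Ty → Type} {M : ℕ}
    {L : LoopCode d I J} {G : DepGraph d I J} (h : IsInvariantSubgraph M L G) (hM : 1 ≤ M)
    (hs : ∀ u v, G.IsLoopPhi u → G.IsLoopPhi v → G.SameSCC u v → u = v)
    {call : Env d J → Val d .arr} {callee : Option (Summary d J .arr)} {pc : Summary d J .arr}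
    (hcallee : (∃ v, L.IsLoopcall v) → callee = some pc)
    (hpc : (∃ v, L.IsLoopcall v) → ∀ ρ', pc.Holds ρ' (call ρ'))
    {Ω : List (List G.Vert)} (hΩ : G.IsSequence Ω) (S₀ : G.Tensor) :
    ∃ post : Summary d I .arr, (∀ b, G.trip + 1 ≤ b → G.liftLevel b callee Ω S₀ = some post) ∧
      ∀ ρ, post.Holds ρ (L.run call ρ) := by
  choose val hval hout using h.exists_isTrace hM call
  have hiff := h.exists_isLoopcall_iff hM
  obtain ⟨post, h1, h2⟩ := DepGraph.exists_liftLevel_eq (h.regular hM) hs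
    (h.1.symm ▸ L.trip_pos) hval (fun hG => hcallee (hiff.1 hG)) (fun hG => hpc (hiff.1 hG)) hΩ S₀
  exact ⟨post, h1, fun ρ => hout ρ ▸ h2 ρ⟩

instance {d : ℕ} {I : Ty → Type} (τ : Ty) : Nonempty (Summary d I τ) :=
  match τ with
  | .idx => ⟨.elem (.ilit 0)⟩
  | .num => ⟨.elem (.nlit 0)⟩
  | .bool => ⟨.elem (.blit false)⟩
  | .arr => ⟨.elem (.nlit 0)⟩

/-- An invariant graph has an admissible plan, and the algorithm is correct for every such plan. -/
theorem IsInvariantGraph.exists_lift_eq {d k M : ℕ} {I : Ty → Type} {P : Kernel d I k}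
    {g : MultiGraph d I k} (hg : IsInvariantGraph M P g) (hM : 1 ≤ M) (hs : g.SingleCarried) :
    (∃ p : Plan g, Plan.Valid g p) ∧
    ∀ p : Plan g, Plan.Valid g p → ∃ (B : ℕ) (post : Summary d I .arr),
      (∀ b : ℕ, B ≤ b → lift b g p = some post) ∧ IsPostcondition P post := by
  induction hg with
  | @base I M L hL G hG =>
    constructor
    · obtain ⟨Ω, hΩ⟩ := DepGraph.exists_isSequence (hG.regular hM) hs
      exact ⟨(Ω, Classical.arbitrary G.Tensor), hΩ⟩
    · intro p hp
      have hno : ¬ ∃ v, L.IsLoopcall v := fun ⟨v, hv⟩ => hL v hv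
      obtain ⟨post, h1, h2⟩ := hG.exists_liftLevel_eq hM hs (callee := none)
        (pc := .elem (.nlit 0)) (call := fun _ => Val.dflt d .arr)
        (fun h => absurd h hno) (fun h => absurd h hno) hp p.2
      exact ⟨G.trip + 1, post, h1, h2⟩
  | @nest I J k M L P h G g hG hg ih =>
    have hM' : 1 ≤ M * L.trip * L.callCount :=
      Nat.mul_pos (Nat.mul_pos hM L.trip_pos) (L.callCount_pos h)
    obtain ⟨hs₁, hs₂⟩ := hs
    obtain ⟨⟨p₀, hp₀⟩, hinner⟩ := ih hM' hs₂
    constructor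
    · obtain ⟨Ω, hΩ⟩ := DepGraph.exists_isSequence (hG.regular hM) hs₁
      exact ⟨((Ω, Classical.arbitrary G.Tensor), p₀), hΩ, hp₀⟩
    · rintro ⟨⟨Ω, S₀⟩, p⟩ ⟨hΩ, hp⟩
      obtain ⟨B, pc, hB, hpc⟩ := hinner p hp
      obtain ⟨post, h1, h2⟩ := hG.exists_liftLevel_eq hM hs₁ (callee := some pc) (pc := pc)
        (call := P.exec) (fun _ => rfl) (fun _ => hpc) hΩ S₀
      refine ⟨max B (G.trip + 1), post, fun b hb => ?_, h2⟩
      change G.liftLevel b (lift b g p) Ω S₀ = some post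
      rw [hB b (le_of_max_le_left hb)]
      exact h1 b (le_of_max_le_right hb)

end StencilLifting

theorem mainTheorem4 {d K : ℕ} {I : StencilLifting.Ty → Type}
    (P : StencilLifting.Kernel d I K) (g : StencilLifting.MultiGraph d I K)
    (hg : StencilLifting.IsInvariantGraph 1 P g) (hs : g.SingleCarried) :
    (∃ p : StencilLifting.Plan g, StencilLifting.Plan.Valid g p) ∧
    ∀ p : StencilLifting.Plan g, StencilLifting.Plan.Valid g p →
      ∃ (B : ℕ) (post : StencilLifting.Summary d I .arr),
        (∀ b : ℕ, B ≤ b → StencilLifting.lift b g p = some post) ∧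
        StencilLifting.IsPostcondition P post :=
  hg.exists_lift_eq le_rfl hs
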